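/- Let $d\ge 2$ and let $B=(b_{ij})_{1\le i,j\le d}$ be a symmetric matrix of functions $b_{ij}\in L^1_{loc}(\mathbb R^d,dx)$ for which there are bounded continuous functions $\lambda_1,\lambda_2$ on $\mathbb R^d$ with $0<\lambda_1\le\lambda_2$ such that, for a.e. $x\in\mathbb R^d$, $$\lambda_1(x)\|\xi\|^2\le\langle B(x)\xi,\xi\rangle\le\lambda_2(x)\|\xi\|^2\qquad\text{for all }\xi\in\mathbb R^d .$$ Let $(\mathcal E,D(\mathcal E))$ be the closure in $L^2(\mathbb R^d,dx)$ of $\mathcal E(f,g)=\frac12\int_{\mathbb R^d}\langle B\nabla f,\nabla g\rangle\,dx$, $f,g\in C_0^\infty(\mathbb R^d)$. For $f\in D(\mathcal E)\cap L^\infty$ let the energy measure $\Gamma(f,f)$ be the Radon measure with $\int\varphi\,d\Gamma(f,f)=2\mathcal E(f,\varphi f)-\mathcal E(f^2,\varphi)$ for all $\varphi\in D(\mathcal E)\cap C_0(\mathbb R^d)$, extended by approximation to $f\in D(\mathcal E)$, and by locality to the set $D(\mathcal E)_{loc}$ of measurable functions that on every compact set agree a.e. with an element of $D(\mathcal E)$.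 Define the intrinsic metric $$d(x,y)=\sup\{f(x)-f(y)\;:\;f\in D(\mathcal E)_{loc}\cap C(\mathbb R^d),\ \Gamma(f,f)\ll dz,\ \tfrac{d\Gamma(f,f)}{dz}\le 1\text{ a.e.}\}\in[0,\infty].$$ Then: 1. $d(x,y)\ge \frac{1}{\sqrt{c_2}}\|x-y\|$ for all $x,y\in\mathbb R^d$, where $c_2=\sup_{\mathbb R^d}\lambda_2$. 2. For every bounded set $D\subset\mathbb R^d$, with $c_D=\inf_D\lambda_1$, and for all $x,y\in D$ such that the line segment from $x$ to $y$ is contained in $D$ (hence for all $x,y\in D$ if $D$ is convex), $c_D>0$ and $d(x,y)\le\frac{1}{\sqrt{c_D}}\|x-y\|$. For an arbitrary bounded set $D$ and all $x,y\in D$, the same holds with $c_D$ replaced by the infimum of $\lambda_1$ over the convex hull of $D$, which is positive. 3. $d$ is a (finite) metric on $\mathbb R^d$ and its topology is the Euclidean topology. -/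

import Mathlib

open MeasureTheory Filter Topology
open scoped BoundedContinuousFunction

namespace DegenerateForm

/-- `d`-dimensional Euclidean space. -/
abbrev E (d : ℕ) : Type := EuclideanSpace ℝ (Fin d)

/-- The Euclidean topology on `ℝᵈ`. -/
abbrev euclideanTopology (d : ℕ) : TopologicalSpace (E d) := inferInstance

/-- The pairing `⟨B ξ, η⟩` of a matrix with two vectors. -/
noncomputable def pairing {d : ℕ} (B : Matrix (Fin d) (Fin d) ℝ) (ξ η : E d) : ℝ :=
  inner ℝ (Matrix.toEuclideanLin B ξ) η

/-- The standing assumptions on the diffusion matrix: `B` is a (Lebesgue-a.e.) symmetric matrix with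
locally integrable entries, and there are bounded continuous functions `0 < lam₁ ≤ lam₂` with
`lam₁(x) ‖ξ‖² ≤ ⟨B(x) ξ, ξ⟩ ≤ lam₂(x) ‖ξ‖²` for almost every `x` and all `ξ`. -/
structure IsDegenerateElliptic {d : ℕ} (B : E d → Matrix (Fin d) (Fin d) ℝ)
    (lam₁ lam₂ : E d →ᵇ ℝ) : Prop where
  locallyIntegrable : ∀ i j, LocallyIntegrable (fun x => B x i j) volume
  symm : ∀ᵐ x ∂(volume : Measure (E d)), (B x).IsSymm
  pos : ∀ x, 0 < lam₁ x
  le : ∀ x, lam₁ x ≤ lam₂ x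
  lower : ∀ᵐ x ∂(volume : Measure (E d)), ∀ ξ : E d, lam₁ x * ‖ξ‖ ^ 2 ≤ pairing (B x) ξ ξ
  upper : ∀ᵐ x ∂(volume : Measure (E d)), ∀ ξ : E d, pairing (B x) ξ ξ ≤ lam₂ x * ‖ξ‖ ^ 2

/-- Smooth functions with compact support. -/
def IsTest {d : ℕ} (u : E d → ℝ) : Prop :=
  ContDiff ℝ (⊤ : ℕ∞) u ∧ HasCompactSupport u

/-- The form `½ ∫ ⟨B ∇f, ∇g⟩ dx`, to be used on test functions `f`, `g`. -/
noncomputable def preForm {d : ℕ} (B : E d → Matrix (Fin d) (Fin d) ℝ) (f g : E d → ℝ) : ℝ :=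
  (1 / 2) * ∫ x, pairing (B x) (gradient f x) (gradient g x)

/-- `u` is a sequence of test functions that is Cauchy for the form and converges to `f` in `L²`. -/
structure IsApprox {d : ℕ} (B : E d → Matrix (Fin d) (Fin d) ℝ) (f : E d → ℝ)
    (u : ℕ → E d → ℝ) : Prop where
  test : ∀ n, IsTest (u n)
  cauchy : Tendsto (fun p : ℕ × ℕ => preForm B (u p.1 - u p.2) (u p.1 - u p.2)) atTop (𝓝 0)
  tendsto : Tendsto (fun n => eLpNorm (u n - f) 2 volume) atTop (𝓝 0)

/-- The domain of the closure in `L²(ℝᵈ, dx)` of the form on test functions. -/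
def InDomain {d : ℕ} (B : E d → Matrix (Fin d) (Fin d) ℝ) (f : E d → ℝ) : Prop :=
  MemLp f 2 volume ∧ ∃ u, IsApprox B f u

open Classical in
/-- The closure of the form on test functions: for `f`, `g` in the domain it is the limit of the
values at approximating test functions. The form being closable, the limit exists and does not
depend on the approximating sequences. -/
noncomputable def form {d : ℕ} (B : E d → Matrix (Fin d) (Fin d) ℝ) (f g : E d → ℝ) : ℝ :=
  if h : InDomain B f ∧ InDomain B g then
    limUnder atTop (fun n => preForm B (h.1.2.choose n) (h.2.2.choose n))
  else 0

/-- `μ` is the energy measure `Γ(f,f)` of a function `f ∈ D(ℰ) ∩ L^∞`: the Radon measure with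
`∫ φ dΓ(f,f) = 2 ℰ(f, φ f) - ℰ(f², φ)` for all `φ ∈ D(ℰ)` continuous with compact support. -/
structure IsEnergyMeasureBdd {d : ℕ} (B : E d → Matrix (Fin d) (Fin d) ℝ) (f : E d → ℝ)
    (μ : Measure (E d)) : Prop where
  domain : InDomain B f
  bounded : MemLp f ⊤ volume
  radon : IsLocallyFiniteMeasure μ
  integral_eq : ∀ φ : E d → ℝ, InDomain B φ → Continuous φ → HasCompactSupport φ →
    ∫ x, φ x ∂μ = 2 * form B f (φ * f) - form B (f * f) φ

/-- `μ` is the energy measure `Γ(f,f)` of a function `f ∈ D(ℰ)`: the vague limit of the energy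
measures of bounded functions in `D(ℰ)` that converge to `f` in the norm `(ℰ(h,h) + ‖h‖²)^(1/2)`. -/
structure IsEnergyMeasure {d : ℕ} (B : E d → Matrix (Fin d) (Fin d) ℝ) (f : E d → ℝ)
    (μ : Measure (E d)) : Prop where
  domain : InDomain B f
  radon : IsLocallyFiniteMeasure μ
  approx : ∃ (g : ℕ → E d → ℝ) (ν : ℕ → Measure (E d)),
    (∀ n, IsEnergyMeasureBdd B (g n) (ν n)) ∧
    Tendsto (fun n => form B (g n - f) (g n - f)) atTop (𝓝 0) ∧
    Tendsto (fun n => eLpNorm (g n - f) 2 volume) atTop (𝓝 0) ∧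
    ∀ φ : E d → ℝ, Continuous φ → HasCompactSupport φ →
      Tendsto (fun n => ∫ x, φ x ∂(ν n)) atTop (𝓝 (∫ x, φ x ∂μ))

/-- `f ∈ D(ℰ)_loc`, and `μ` is its energy measure: on every compact set `K`, `f` agrees almost
everywhere with some `g ∈ D(ℰ)`, and `μ` agrees with `Γ(g,g)` on the interior of `K`
(`Γ(g,g)` does not depend there on the choice of `g`, because the form is strongly local). -/
structure IsEnergyMeasureLoc {d : ℕ} (B : E d → Matrix (Fin d) (Fin d) ℝ) (f : E d → ℝ)
    (μ : Measure (E d)) : Prop where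
  measurable : Measurable f
  radon : IsLocallyFiniteMeasure μ
  local_eq : ∀ K : Set (E d), IsCompact K → ∃ (g : E d → ℝ) (ν : Measure (E d)),
    (∀ᵐ x ∂volume.restrict K, f x = g x) ∧ IsEnergyMeasure B g ν ∧
    μ.restrict (interior K) = ν.restrict (interior K)

/-- The continuous functions `f ∈ D(ℰ)_loc` whose energy measure `Γ(f,f)` is absolutely continuous
with respect to Lebesgue measure, with density at most `1`. -/
def admissible {d : ℕ} (B : E d → Matrix (Fin d) (Fin d) ℝ) : Set (E d → ℝ) :=
  {f | Continuous f ∧ ∃ μ : Measure (E d), IsEnergyMeasureLoc B f μ ∧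
    μ ≪ volume ∧ ∀ᵐ x ∂(volume : Measure (E d)), μ.rnDeriv volume x ≤ 1}

/-- The intrinsic (pseudo-)metric `sup {f(x) - f(y)}` over the admissible functions `f`, as an
extended real number. -/
noncomputable def intrinsicDist {d : ℕ} (B : E d → Matrix (Fin d) (Fin d) ℝ) (x y : E d) : EReal :=
  ⨆ f ∈ admissible B, ((f x - f y : ℝ) : EReal)

end DegenerateForm

/-!
The intrinsic metric of a degenerate elliptic form is compared with the Euclidean metric by linear
functions from below and by a Lipschitz bound for admissible functions from above.

**The form.** All values of `form` are computed along approximating sequences of test functions.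
That the choice of the sequence is immaterial (`IsDegenerateElliptic.tendsto_form`) is closability
(`IsDegenerateElliptic.tendsto_energy_zero`): if `uₙ → 0` in `L²` with bounded energy, then
`∫ ⟨∇uₙ, B ∇v⟩ → 0` for every test function `v`, because `B ∇v` is an `L²` limit of smooth fields
supported in one compact set, where `λ₁` is bounded away from zero. Multiplication by a test
function and composition with smooth functions of compact support vanishing at `0` act on
approximating sequences (`isApprox_mul`, `isApprox_comp`).

**Lower bound.** A test function `g` has energy measure `⟨B ∇g, ∇g⟩ dx`. Hence the linear function
`⟨e, ·⟩`, which agrees with a test function on each compact set, has energy measure `⟨B e, e⟩ dx`,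
and is admissible as soon as `(sup λ₂) ‖e‖² ≤ 1`.

**Upper bound.** No weak gradient of a general element of the domain is constructed. Instead, the
energy measure `μ` of `f` is shown to satisfy
`(∫ f ∂ₑφ)² ≤ c⁻¹ (∫ φ) (∫ φ dμ)` for test functions `φ ≥ 0` with `λ₁ ≥ c` on the support of `φ`
(`DerivBound`). For test functions `f` this is integration by parts and the Cauchy–Schwarz
inequality. It passes to bounded `f` in the domain, because
`2 ℰ(u, φ u) - ℰ(u², φ) = ∫ φ ⟨B ∇u, ∇u⟩` for test functions `u` and both sides converge along an
approximating sequence of `f` (`tendsto_integral_energy`), then to general `f` in the domain and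
to `f` locally in the domain, since it involves `f` and `μ` only through integrals against test
functions. If `f` is admissible, then `μ ≤ dx`, and a mollifier in the place of `φ` shows that the
mollified `f` has gradient at most `1 / √c` on a segment near which `λ₁ ≥ c`
(`abs_convolution_sub_le`). Integrating along the segment and removing the mollification gives the
bound on `f x - f y`.

The two bounds make the intrinsic metric finite, positive off the diagonal and locally comparable
with the Euclidean metric. It is symmetric since `-f` is admissible along with `f`.
-/

namespace DegenerateForm

open scoped ContDiff

variable {d : ℕ}

/-! ### Test functions and their gradients -/

lemma IsTest.differentiable {u : E d → ℝ} (hu : IsTest u) : Differentiable ℝ u :=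
  hu.1.differentiable (by simp)

lemma IsTest.continuous {u : E d → ℝ} (hu : IsTest u) : Continuous u := hu.1.continuous

lemma isTest_zero : IsTest (0 : E d → ℝ) :=
  ⟨contDiff_const, HasCompactSupport.zero⟩

lemma IsTest.neg {u : E d → ℝ} (hu : IsTest u) : IsTest (-u) :=
  ⟨hu.1.neg, hu.2.neg⟩

lemma IsTest.sub {u v : E d → ℝ} (hu : IsTest u) (hv : IsTest v) : IsTest (u - v) :=
  ⟨hu.1.sub hv.1, hu.2.sub hv.2⟩

lemma IsTest.mul_left {u v : E d → ℝ} (hu : ContDiff ℝ ∞ u) (hv : IsTest v) : IsTest (u * v) :=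
  ⟨hu.mul hv.1, hv.2.mul_left⟩

lemma IsTest.mul {u v : E d → ℝ} (hu : IsTest u) (hv : IsTest v) : IsTest (u * v) :=
  IsTest.mul_left hu.1 hv

lemma IsTest.comp {u : E d → ℝ} (hu : IsTest u) {S : ℝ → ℝ} (hS : ContDiff ℝ ∞ S)
    (h0 : S 0 = 0) : IsTest (S ∘ u) :=
  ⟨hS.comp hu.1, hu.2.comp_left h0⟩

lemma gradient_neg (u : E d → ℝ) : gradient (-u) = -gradient u := by
  funext x
  simp [gradient, fderiv_neg]

lemma gradient_sub {u v : E d → ℝ} (hu : Differentiable ℝ u) (hv : Differentiable ℝ v) :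
    gradient (u - v) = gradient u - gradient v := by
  funext x
  simp [gradient, fderiv_sub (hu x) (hv x)]

lemma gradient_mul {u v : E d → ℝ} (hu : Differentiable ℝ u) (hv : Differentiable ℝ v) :
    gradient (u * v) = u • gradient v + v • gradient u := by
  funext x
  simp [gradient, fderiv_mul (hu x) (hv x)]

lemma gradient_comp {u : E d → ℝ} (hu : Differentiable ℝ u) {S : ℝ → ℝ}
    (hS : Differentiable ℝ S) : gradient (S ∘ u) = (fun x => deriv S (u x)) • gradient u := by
  funext x
  have := ((hS (u x)).hasDerivAt.comp_hasFDerivAt x (hu x).hasFDerivAt).fderiv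
  simp [gradient, this]

lemma gradient_inner_const (e : E d) : gradient (fun x : E d => inner ℝ e x) = fun _ => e := by
  funext x
  apply HasGradientAt.gradient
  rw [hasGradientAt_iff_hasFDerivAt]
  exact (innerSL ℝ e).hasFDerivAt

lemma IsTest.continuous_gradient {u : E d → ℝ} (hu : IsTest u) : Continuous (gradient u) :=
  (LinearIsometryEquiv.continuous _).comp (hu.1.continuous_fderiv (by simp))

lemma IsTest.hasCompactSupport_gradient {u : E d → ℝ} (hu : IsTest u) :
    HasCompactSupport (gradient u) :=
  (hu.2.fderiv (𝕜 := ℝ)).comp_left (map_zero _)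

lemma IsTest.memLp {u : E d → ℝ} (hu : IsTest u) : MemLp u 2 volume :=
  hu.continuous.memLp_of_hasCompactSupport hu.2

lemma IsTest.memLp_top {u : E d → ℝ} (hu : IsTest u) : MemLp u ⊤ volume :=
  hu.continuous.memLp_of_hasCompactSupport hu.2

lemma IsTest.integrable {u : E d → ℝ} (hu : IsTest u) : Integrable u volume :=
  hu.continuous.integrable_of_hasCompactSupport hu.2

lemma IsTest.memLp_gradient {u : E d → ℝ} (hu : IsTest u) : MemLp (gradient u) 2 volume :=
  hu.continuous_gradient.memLp_of_hasCompactSupport hu.hasCompactSupport_gradient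

lemma exists_bound_of_compactSupport {F : Type*} [NormedAddCommGroup F] {u : E d → F}
    (hu : Continuous u) (hc : HasCompactSupport u) : ∃ C, 0 < C ∧ ∀ x, ‖u x‖ ≤ C := by
  obtain ⟨C, hC⟩ := hu.bounded_above_of_compact_support hc
  exact ⟨max C 1, by positivity, fun x => (hC x).trans (le_max_left _ _)⟩

lemma IsTest.exists_bound {u : E d → ℝ} (hu : IsTest u) : ∃ C, 0 < C ∧ ∀ x, |u x| ≤ C :=
  exists_bound_of_compactSupport hu.continuous hu.2

lemma IsTest.exists_bound_gradient {u : E d → ℝ} (hu : IsTest u) :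
    ∃ C, 0 < C ∧ ∀ x, ‖gradient u x‖ ≤ C :=
  exists_bound_of_compactSupport hu.continuous_gradient hu.hasCompactSupport_gradient

/-- A test function with values in `[0, 1]` that is `1` near a given compact set. -/
lemma exists_cutoff {K : Set (E d)} (hK : IsCompact K) :
    ∃ χ : E d → ℝ, IsTest χ ∧ (∀ x ∈ K, χ =ᶠ[𝓝 x] 1) ∧ (∀ x, 0 ≤ χ x) ∧ ∀ x, χ x ≤ 1 := by
  obtain ⟨R, hR, hKR⟩ := hK.isBounded.subset_ball_lt 0 (0 : E d)
  let b : ContDiffBump (0 : E d) := ⟨R, R + 1, hR, by linarith⟩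
  refine ⟨b, ⟨b.contDiff, b.hasCompactSupport⟩, fun x hx => ?_, fun x => b.nonneg,
    fun x => b.le_one⟩
  exact b.eventuallyEq_one_of_mem_ball (hKR hx)

lemma IsTest.integral_fderiv_mul {u ψ : E d → ℝ} (hu : IsTest u) (hψ : IsTest ψ) (e : E d) :
    ∫ x, fderiv ℝ u x e * ψ x = -∫ x, u x * fderiv ℝ ψ x e := by
  have hcu : Continuous (fun x => fderiv ℝ u x e) :=
    (hu.1.continuous_fderiv (by simp)).clm_apply continuous_const
  have hcψ : Continuous (fun x => fderiv ℝ ψ x e) :=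
    (hψ.1.continuous_fderiv (by simp)).clm_apply continuous_const
  rw [integral_mul_fderiv_eq_neg_fderiv_mul_of_integrable, neg_neg]
  · exact (hcu.mul hψ.continuous).integrable_of_hasCompactSupport hψ.2.mul_left
  · exact (hu.continuous.mul hcψ).integrable_of_hasCompactSupport hu.2.mul_right
  · exact (hu.continuous.mul hψ.continuous).integrable_of_hasCompactSupport hu.2.mul_right
  · exact fun x _ => hu.differentiable x
  · exact fun x _ => hψ.differentiable x

/-! ### Convergence in mean square -/

lemma integral_sq_nonneg (f : E d → ℝ) : 0 ≤ ∫ x, f x ^ 2 :=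
  integral_nonneg fun _ => sq_nonneg _

lemma eLpNorm_two_eq {f : E d → ℝ} (hf : MemLp f 2 volume) :
    eLpNorm f 2 volume = ENNReal.ofReal (√(∫ x, f x ^ 2)) := by
  rw [hf.eLpNorm_eq_integral_rpow_norm (by norm_num) (by norm_num), Real.sqrt_eq_rpow]
  simp [ENNReal.toReal_ofNat]

lemma tendsto_eLpNorm_two_iff {ι : Type*} {l : Filter ι} {f : ι → E d → ℝ}
    (hf : ∀ i, MemLp (f i) 2 volume) :
    Tendsto (fun i => eLpNorm (f i) 2 volume) l (𝓝 0) ↔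
      Tendsto (fun i => ∫ x, f i x ^ 2) l (𝓝 0) := by
  simp_rw [fun i => eLpNorm_two_eq (hf i)]
  constructor
  · intro h
    have h1 := (ENNReal.tendsto_toReal ENNReal.zero_ne_top).comp h
    have h2 := h1.pow 2
    simp only [Function.comp_def, ENNReal.toReal_ofReal (Real.sqrt_nonneg _), ENNReal.toReal_zero,
      ne_eq, OfNat.ofNat_ne_zero, not_false_eq_true, zero_pow] at h2
    refine h2.congr fun i => Real.sq_sqrt (integral_sq_nonneg _)
  · intro h
    have := ENNReal.tendsto_ofReal (h.sqrt)
    simpa using this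

/-- The square of the integral of a product is at most the product of the integrals of the
squares. -/
lemma sq_integral_mul_le {f g : E d → ℝ} (hf : MemLp f 2 volume) (hg : MemLp g 2 volume) :
    (∫ x, f x * g x) ^ 2 ≤ (∫ x, f x ^ 2) * ∫ x, g x ^ 2 := by
  have h := discrim_le_zero (a := ∫ x, g x ^ 2) (b := 2 * ∫ x, f x * g x) (c := ∫ x, f x ^ 2)
    (fun t => by
      have h0 : 0 ≤ ∫ x, (f x + t * g x) ^ 2 := integral_sq_nonneg _
      have : ∫ x, (f x + t * g x) ^ 2
          = (∫ x, g x ^ 2) * (t * t) + (2 * ∫ x, f x * g x) * t + ∫ x, f x ^ 2 := by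
        have h1 : ∀ x, (f x + t * g x) ^ 2
            = t * t * g x ^ 2 + 2 * t * (f x * g x) + f x ^ 2 := fun x => by ring
        simp_rw [h1]
        rw [integral_add, integral_add, integral_const_mul, integral_const_mul]
        · ring
        · exact hg.integrable_sq.const_mul _
        · exact (hf.integrable_mul hg).const_mul _
        · exact (hg.integrable_sq.const_mul _).add ((hf.integrable_mul hg).const_mul _)
        · exact hf.integrable_sq
      linarith)
  rw [discrim] at h
  nlinarith

/-- Pairing with a fixed square integrable function is continuous in mean square. -/
lemma tendsto_integral_mul_zero {ι : Type*} {l : Filter ι} {f g : ι → E d → ℝ} {C : ℝ}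
    (hf : ∀ i, MemLp (f i) 2 volume) (hg : ∀ i, MemLp (g i) 2 volume)
    (h : Tendsto (fun i => ∫ x, f i x ^ 2) l (𝓝 0)) (hC : ∀ᶠ i in l, ∫ x, g i x ^ 2 ≤ C) :
    Tendsto (fun i => ∫ x, f i x * g i x) l (𝓝 0) := by
  have h2 : Tendsto (fun i => √((∫ x, f i x ^ 2) * C)) l (𝓝 0) := by
    simpa using (h.mul_const C).sqrt
  refine squeeze_zero_norm' ?_ h2
  filter_upwards [hC] with i hi
  rw [Real.norm_eq_abs]
  apply Real.abs_le_sqrt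
  exact (sq_integral_mul_le (hf i) (hg i)).trans
    (mul_le_mul_of_nonneg_left hi (integral_sq_nonneg _))

lemma tendsto_integral_mul {f g : E d → ℝ} (hf : MemLp f 2 volume) (hg : MemLp g 2 volume)
    {u : ℕ → E d → ℝ} (hu : ∀ n, MemLp (u n) 2 volume)
    (h : Tendsto (fun n => ∫ x, (u n x - f x) ^ 2) atTop (𝓝 0)) :
    Tendsto (fun n => ∫ x, u n x * g x) atTop (𝓝 (∫ x, f x * g x)) := by
  have h1 := (tendsto_integral_mul_zero (f := fun n x => u n x - f x) (fun n => (hu n).sub hf)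
    (fun _ => hg) h (Eventually.of_forall fun _ => le_rfl)).add_const (∫ x, f x * g x)
  rw [zero_add] at h1
  refine h1.congr fun n => ?_
  have i1 : Integrable (fun x => (u n x - f x) * g x) := ((hu n).sub hf).integrable_mul hg
  have i2 : Integrable (fun x => f x * g x) := hf.integrable_mul hg
  rw [← integral_add i1 i2]
  refine integral_congr_ae (Eventually.of_forall fun x => ?_)
  simp only
  ring

/-! ### The pairing and its integral over square integrable vector fields -/

lemma pairing_add_left (M : Matrix (Fin d) (Fin d) ℝ) (ξ ξ' η : E d) :
    pairing M (ξ + ξ') η = pairing M ξ η + pairing M ξ' η := by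
  simp [pairing, inner_add_left]

lemma pairing_add_right (M : Matrix (Fin d) (Fin d) ℝ) (ξ η η' : E d) :
    pairing M ξ (η + η') = pairing M ξ η + pairing M ξ η' := by
  simp [pairing, inner_add_right]

lemma pairing_smul_left (M : Matrix (Fin d) (Fin d) ℝ) (t : ℝ) (ξ η : E d) :
    pairing M (t • ξ) η = t * pairing M ξ η := by
  simp [pairing, inner_smul_left]

lemma pairing_smul_right (M : Matrix (Fin d) (Fin d) ℝ) (t : ℝ) (ξ η : E d) :
    pairing M ξ (t • η) = t * pairing M ξ η := by
  simp [pairing, inner_smul_right]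

lemma pairing_neg_left (M : Matrix (Fin d) (Fin d) ℝ) (ξ η : E d) :
    pairing M (-ξ) η = -pairing M ξ η := by
  simp [pairing]

lemma pairing_neg_right (M : Matrix (Fin d) (Fin d) ℝ) (ξ η : E d) :
    pairing M ξ (-η) = -pairing M ξ η := by
  simp [pairing]

lemma pairing_eq_sum (M : Matrix (Fin d) (Fin d) ℝ) (ξ η : E d) :
    pairing M ξ η = ∑ i, ∑ j, M i j * ξ j * η i := by
  simp [pairing, PiLp.inner_apply, Matrix.toLpLin_apply, Matrix.mulVec, dotProduct,
    Finset.mul_sum, mul_comm]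

lemma pairing_comm {M : Matrix (Fin d) (Fin d) ℝ} (hM : M.IsSymm) (ξ η : E d) :
    pairing M ξ η = pairing M η ξ := by
  rw [pairing_eq_sum, pairing_eq_sum, Finset.sum_comm]
  refine Finset.sum_congr rfl fun i _ => Finset.sum_congr rfl fun j _ => ?_
  rw [hM.apply i j]
  ring

/-- The Cauchy–Schwarz inequality for a positive semidefinite symmetric matrix. -/
lemma sq_pairing_le {M : Matrix (Fin d) (Fin d) ℝ} (hM : M.IsSymm)
    (h0 : ∀ ξ, 0 ≤ pairing M ξ ξ) (ξ η : E d) :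
    pairing M ξ η ^ 2 ≤ pairing M ξ ξ * pairing M η η := by
  have h := discrim_le_zero (a := pairing M η η) (b := 2 * pairing M ξ η) (c := pairing M ξ ξ)
    (fun t => by
      have := h0 (ξ + t • η)
      simp only [pairing_add_left, pairing_add_right, pairing_smul_left, pairing_smul_right,
        pairing_comm hM η ξ] at this
      linarith)
  rw [discrim] at h
  nlinarith

variable {B : E d → Matrix (Fin d) (Fin d) ℝ} {lam₁ lam₂ : E d →ᵇ ℝ}

namespace IsDegenerateElliptic

lemma exists_bound (_hB : IsDegenerateElliptic B lam₁ lam₂) : ∃ C, 0 < C ∧ ∀ x, lam₂ x ≤ C := by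
  refine ⟨max ‖lam₂‖ 1, by positivity, fun x => ?_⟩
  exact ((le_abs_self _).trans (lam₂.norm_coe_le_norm x)).trans (le_max_left _ _)

lemma pairing_nonneg (hB : IsDegenerateElliptic B lam₁ lam₂) :
    ∀ᵐ x ∂(volume : Measure (E d)), ∀ ξ, 0 ≤ pairing (B x) ξ ξ := by
  filter_upwards [hB.lower] with x hx ξ
  exact (mul_nonneg (hB.pos x).le (sq_nonneg _)).trans (hx ξ)

lemma norm_apply_le (hB : IsDegenerateElliptic B lam₁ lam₂) {C : ℝ} (hC : 0 < C)
    (hl : ∀ x, lam₂ x ≤ C) :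
    ∀ᵐ x ∂(volume : Measure (E d)), ∀ ξ, ‖Matrix.toEuclideanLin (B x) ξ‖ ≤ C * ‖ξ‖ := by
  filter_upwards [hB.pairing_nonneg, hB.symm, hB.upper] with x h0 hs hu ξ
  have h1 := sq_pairing_le hs h0 ξ (Matrix.toEuclideanLin (B x) ξ)
  have hu' : ∀ ξ, pairing (B x) ξ ξ ≤ C * ‖ξ‖ ^ 2 := fun ξ =>
    (hu ξ).trans (mul_le_mul_of_nonneg_right (hl x) (sq_nonneg _))
  have h2 := hu' ξ
  have h3 := hu' (Matrix.toEuclideanLin (B x) ξ)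
  have h4 : pairing (B x) ξ (Matrix.toEuclideanLin (B x) ξ)
      = ‖Matrix.toEuclideanLin (B x) ξ‖ ^ 2 := by
    rw [pairing, real_inner_self_eq_norm_sq]
  rw [h4] at h1
  set a := ‖Matrix.toEuclideanLin (B x) ξ‖
  have h5 : (a ^ 2) ^ 2 ≤ (C * ‖ξ‖ ^ 2) * (C * a ^ 2) :=
    h1.trans (mul_le_mul h2 h3 (h0 _) (by positivity))
  by_contra! hlt
  have ha : 0 < a := lt_of_le_of_lt (by positivity) hlt
  have h6 : (C * ‖ξ‖) ^ 2 < a ^ 2 := by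
    apply pow_lt_pow_left₀ hlt (by positivity) (by norm_num)
  have h7 : (C * ‖ξ‖) ^ 2 * a ^ 2 < a ^ 2 * a ^ 2 := mul_lt_mul_of_pos_right h6 (by positivity)
  nlinarith

lemma aestronglyMeasurable_apply (hB : IsDegenerateElliptic B lam₁ lam₂) {X : E d → E d}
    (hX : AEStronglyMeasurable X volume) :
    AEStronglyMeasurable (fun x => Matrix.toEuclideanLin (B x) (X x)) volume := by
  have h : AEStronglyMeasurable (fun x => fun i => ∑ j, B x i j * X x j) volume := by
    refine (aemeasurable_pi_iff.2 fun i => AEStronglyMeasurable.aemeasurable ?_).aestronglyMeasurable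
    refine Finset.aestronglyMeasurable_fun_sum _ fun j _ => ?_
    refine (hB.locallyIntegrable i j).aestronglyMeasurable.mul ?_
    exact (EuclideanSpace.proj (𝕜 := ℝ) j).continuous.comp_aestronglyMeasurable hX
  have h2 := (PiLp.continuous_toLp 2 (fun _ : Fin d => ℝ)).comp_aestronglyMeasurable h
  refine h2.congr (Eventually.of_forall fun x => ?_)
  simp only [Matrix.toLpLin_apply]
  rfl

lemma memLp_apply (hB : IsDegenerateElliptic B lam₁ lam₂) {X : E d → E d}
    (hX : MemLp X 2 volume) :
    MemLp (fun x => Matrix.toEuclideanLin (B x) (X x)) 2 volume := by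
  obtain ⟨C, hC, hl⟩ := hB.exists_bound
  refine hX.of_le_mul (c := C) (hB.aestronglyMeasurable_apply hX.1) ?_
  filter_upwards [hB.norm_apply_le hC hl] with x hx using hx _

lemma aestronglyMeasurable_pairing (hB : IsDegenerateElliptic B lam₁ lam₂) {X Y : E d → E d}
    (hX : AEStronglyMeasurable X volume) (hY : AEStronglyMeasurable Y volume) :
    AEStronglyMeasurable (fun x => pairing (B x) (X x) (Y x)) volume :=
  (hB.aestronglyMeasurable_apply hX).inner hY

lemma integrable_pairing (hB : IsDegenerateElliptic B lam₁ lam₂) {X Y : E d → E d}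
    (hX : MemLp X 2 volume) (hY : MemLp Y 2 volume) :
    Integrable (fun x => pairing (B x) (X x) (Y x)) volume := by
  refine ((hB.memLp_apply hX).norm.integrable_mul hY.norm).mono
    (hB.aestronglyMeasurable_pairing hX.1 hY.1) (Eventually.of_forall fun x => ?_)
  refine (norm_inner_le_norm _ _).trans ?_
  simp

end IsDegenerateElliptic

/-- The integral `∫ ⟨B X, Y⟩ dx` of two vector fields `X`, `Y`. -/
noncomputable def fieldForm (B : E d → Matrix (Fin d) (Fin d) ℝ) (X Y : E d → E d) : ℝ :=
  ∫ x, pairing (B x) (X x) (Y x)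

lemma preForm_eq (f g : E d → ℝ) :
    preForm B f g = (1 / 2) * fieldForm B (gradient f) (gradient g) := rfl

namespace IsDegenerateElliptic

variable (hB : IsDegenerateElliptic B lam₁ lam₂) {X Y Z : E d → E d}
include hB

lemma fieldForm_comm (X Y : E d → E d) : fieldForm B X Y = fieldForm B Y X := by
  apply integral_congr_ae
  filter_upwards [hB.symm] with x hx using pairing_comm hx _ _

lemma fieldForm_self_nonneg (X : E d → E d) : 0 ≤ fieldForm B X X := by
  apply integral_nonneg_of_ae
  filter_upwards [hB.pairing_nonneg] with x hx using hx _

lemma fieldForm_add_left (hX : MemLp X 2 volume) (hY : MemLp Y 2 volume) (hZ : MemLp Z 2 volume) :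
    fieldForm B (X + Y) Z = fieldForm B X Z + fieldForm B Y Z := by
  simp only [fieldForm, Pi.add_apply, pairing_add_left]
  exact integral_add (hB.integrable_pairing hX hZ) (hB.integrable_pairing hY hZ)

lemma fieldForm_sub_left (hX : MemLp X 2 volume) (hY : MemLp Y 2 volume) (hZ : MemLp Z 2 volume) :
    fieldForm B (X - Y) Z = fieldForm B X Z - fieldForm B Y Z := by
  simp only [fieldForm, sub_eq_add_neg, Pi.add_apply, Pi.neg_apply, pairing_add_left,
    pairing_neg_left]
  exact integral_sub (hB.integrable_pairing hX hZ) (hB.integrable_pairing hY hZ)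

lemma fieldForm_add_right (hX : MemLp X 2 volume) (hY : MemLp Y 2 volume)
    (hZ : MemLp Z 2 volume) :
    fieldForm B X (Y + Z) = fieldForm B X Y + fieldForm B X Z := by
  simp only [hB.fieldForm_comm X, hB.fieldForm_add_left hY hZ hX]

lemma fieldForm_sub_right (hX : MemLp X 2 volume) (hY : MemLp Y 2 volume)
    (hZ : MemLp Z 2 volume) :
    fieldForm B X (Y - Z) = fieldForm B X Y - fieldForm B X Z := by
  simp only [hB.fieldForm_comm X, hB.fieldForm_sub_left hY hZ hX]

omit hB in
lemma _root_.DegenerateForm.fieldForm_smul_left (t : ℝ) (X Y : E d → E d) :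
    fieldForm B (t • X) Y = t * fieldForm B X Y := by
  simp [fieldForm, pairing_smul_left, integral_const_mul]

/-- The Cauchy–Schwarz inequality for `∫ ⟨B X, Y⟩ dx`. -/
lemma sq_fieldForm_le (hX : MemLp X 2 volume) (hY : MemLp Y 2 volume) :
    fieldForm B X Y ^ 2 ≤ fieldForm B X X * fieldForm B Y Y := by
  have h := discrim_le_zero (a := fieldForm B Y Y) (b := 2 * fieldForm B X Y)
    (c := fieldForm B X X)
    (fun t => by
      have h0 := hB.fieldForm_self_nonneg (X + t • Y)
      have hY' : MemLp (t • Y) 2 volume := hY.const_smul t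
      rw [hB.fieldForm_add_left hX hY' (hX.add hY'), hB.fieldForm_add_right hX hX hY',
        hB.fieldForm_add_right hY' hX hY', hB.fieldForm_comm X (t • Y), fieldForm_smul_left,
        fieldForm_smul_left, hB.fieldForm_comm Y (t • Y), fieldForm_smul_left,
        hB.fieldForm_comm Y X] at h0
      linarith)
  rw [discrim] at h
  nlinarith

/-- The parallelogram inequality for the quadratic form `∫ ⟨B X, X⟩ dx`. -/
lemma fieldForm_add_self_le (hX : MemLp X 2 volume) (hY : MemLp Y 2 volume) :
    fieldForm B (X + Y) (X + Y) ≤ 2 * fieldForm B X X + 2 * fieldForm B Y Y := by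
  have h0 := hB.fieldForm_self_nonneg (X - Y)
  rw [hB.fieldForm_sub_left hX hY (hX.sub hY), hB.fieldForm_sub_right hX hX hY,
    hB.fieldForm_sub_right hY hX hY] at h0
  rw [hB.fieldForm_add_left hX hY (hX.add hY), hB.fieldForm_add_right hX hX hY,
    hB.fieldForm_add_right hY hX hY]
  linarith

/-- Multiplying a vector field by a function bounded by `C` costs at most a factor `C ^ 2`. -/
lemma fieldForm_smul_self_le {φ : E d → ℝ} {C : ℝ} (hφ : AEStronglyMeasurable φ volume)
    (hC : ∀ x, |φ x| ≤ C) (hX : MemLp X 2 volume) :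
    fieldForm B (φ • X) (φ • X) ≤ C ^ 2 * fieldForm B X X := by
  have hφX : MemLp (φ • X) 2 volume := by
    refine hX.of_le_mul (c := C) (hφ.smul hX.1) (Eventually.of_forall fun x => ?_)
    simp only [Pi.smul_apply', norm_smul, Real.norm_eq_abs]
    exact mul_le_mul_of_nonneg_right (hC x) (norm_nonneg _)
  rw [fieldForm, fieldForm, ← integral_const_mul]
  refine integral_mono_ae (hB.integrable_pairing hφX hφX)
    ((hB.integrable_pairing hX hX).const_mul _) ?_
  filter_upwards [hB.pairing_nonneg] with x hx
  simp only [Pi.smul_apply', pairing_smul_left, pairing_smul_right, ← mul_assoc, ← pow_two]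
  exact mul_le_mul_of_nonneg_right (sq_le_sq' (abs_le.1 (hC x)).1 (abs_le.1 (hC x)).2) (hx _)

/-- Multiplying a bounded vector field by a square integrable function. -/
lemma exists_fieldForm_smul_self_le {M : ℝ} (hM : ∀ x, ‖X x‖ ≤ M)
    (hX : AEStronglyMeasurable X volume) :
    ∃ K, 0 ≤ K ∧ ∀ w : E d → ℝ, MemLp w 2 volume →
      fieldForm B (w • X) (w • X) ≤ K * ∫ x, w x ^ 2 := by
  obtain ⟨C, hC, hl⟩ := hB.exists_bound
  refine ⟨C * M ^ 2, by positivity, fun w hw => ?_⟩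
  have hwX : MemLp (w • X) 2 volume := by
    refine hw.of_le_mul (c := M) (hw.1.smul hX) (Eventually.of_forall fun x => ?_)
    simp only [Pi.smul_apply', norm_smul]
    rw [mul_comm]
    exact mul_le_mul_of_nonneg_right (hM x) (norm_nonneg _)
  rw [fieldForm, ← integral_const_mul]
  refine integral_mono_ae (hB.integrable_pairing hwX hwX) (hw.integrable_sq.const_mul _) ?_
  filter_upwards [hB.upper] with x hx
  simp only [Pi.smul_apply', pairing_smul_left, pairing_smul_right, ← mul_assoc, ← pow_two]
  have h1 : pairing (B x) (X x) (X x) ≤ C * M ^ 2 := by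
    refine (hx _).trans (mul_le_mul (hl x) ?_ (sq_nonneg _) hC.le)
    exact pow_le_pow_left₀ (norm_nonneg _) (hM x) 2
  nlinarith [sq_nonneg (w x)]

end IsDegenerateElliptic

/-! ### Closability of the form -/

/-- The energy `∫ ⟨B ∇u, ∇u⟩ dx` of a test function `u`, twice the value of the form. -/
noncomputable def energy (B : E d → Matrix (Fin d) (Fin d) ℝ) (u : E d → ℝ) : ℝ :=
  fieldForm B (gradient u) (gradient u)

lemma tendsto_atTop_prod_zero_iff {a : ℕ → ℕ → ℝ} (ha : ∀ m n, 0 ≤ a m n) :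
    Tendsto (fun p : ℕ × ℕ => a p.1 p.2) atTop (𝓝 0) ↔
      ∀ ε > 0, ∃ N, ∀ m ≥ N, ∀ n ≥ N, a m n < ε := by
  rw [Metric.tendsto_atTop]
  constructor
  · intro h ε hε
    obtain ⟨N, hN⟩ := h ε hε
    refine ⟨max N.1 N.2, fun m hm n hn => ?_⟩
    have := hN (m, n) ⟨(le_max_left _ _).trans hm, (le_max_right _ _).trans hn⟩
    simpa [Real.dist_eq, abs_of_nonneg (ha m n)] using this
  · intro h ε hε
    obtain ⟨N, hN⟩ := h ε hε
    refine ⟨(N, N), fun p hp => ?_⟩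
    simpa [Real.dist_eq, abs_of_nonneg (ha p.1 p.2)] using hN p.1 hp.1 p.2 hp.2

lemma inner_gradient_eq_sum (u : E d → ℝ) (x η : E d) :
    inner ℝ (gradient u x) η = ∑ i, fderiv ℝ u x (EuclideanSpace.single i 1) * η i := by
  have h : ∀ i, gradient u x i = fderiv ℝ u x (EuclideanSpace.single i 1) := by
    intro i
    rw [← inner_gradient_left, EuclideanSpace.inner_single_right]
    simp
  rw [PiLp.inner_apply]
  exact Finset.sum_congr rfl fun i _ => by simp [h, mul_comm]

/-- Gradients of test functions that vanish in mean square in the limit tend to zero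
in the sense of distributions. -/
lemma tendsto_integral_inner_gradient_smooth {u : ℕ → E d → ℝ} (hu : ∀ n, IsTest (u n))
    (h0 : Tendsto (fun n => ∫ x, u n x ^ 2) atTop (𝓝 0)) {Ψ : E d → E d}
    (hΨ : ContDiff ℝ ∞ Ψ) (hc : HasCompactSupport Ψ) :
    Tendsto (fun n => ∫ x, inner ℝ (gradient (u n) x) (Ψ x)) atTop (𝓝 0) := by
  have hΨi : ∀ i, IsTest (fun x => Ψ x i) := fun i =>
    ⟨(EuclideanSpace.proj (𝕜 := ℝ) i).contDiff.comp hΨ,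
      hc.comp_left (g := fun v : E d => v i) rfl⟩
  have hint : ∀ n i, Integrable
      (fun x => fderiv ℝ (u n) x (EuclideanSpace.single i 1) * Ψ x i) := fun n i =>
    ((((hu n).1.continuous_fderiv (by simp)).clm_apply continuous_const).mul
      (hΨi i).continuous).integrable_of_hasCompactSupport (hΨi i).2.mul_left
  simp_rw [inner_gradient_eq_sum]
  have : ∀ n, ∫ x, ∑ i, fderiv ℝ (u n) x (EuclideanSpace.single i 1) * Ψ x i
      = ∑ i, -∫ x, u n x * fderiv ℝ (fun x => Ψ x i) x (EuclideanSpace.single i 1) := by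
    intro n
    rw [integral_finsetSum _ fun i _ => hint n i]
    exact Finset.sum_congr rfl fun i _ => (hu n).integral_fderiv_mul (hΨi i) _
  simp_rw [this]
  rw [show (0 : ℝ) = ∑ i : Fin d, -0 by simp]
  refine tendsto_finsetSum _ fun i _ => Tendsto.neg ?_
  refine tendsto_integral_mul_zero (fun n => (hu n).memLp) (fun _ => ?_) h0
    (Eventually.of_forall fun _ => le_rfl)
  exact (((hΨi i).1.continuous_fderiv (by simp)).clm_apply
    continuous_const).memLp_of_hasCompactSupport ((hΨi i).2.fderiv_apply (𝕜 := ℝ) _)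

/-- A continuous positive function has a positive lower bound on a compact set. -/
lemma exists_pos_le_on_compact {l : E d → ℝ} (hl : Continuous l) (hpos : ∀ x, 0 < l x)
    {K : Set (E d)} (hK : IsCompact K) : ∃ c, 0 < c ∧ ∀ x ∈ K, c ≤ l x := by
  obtain ⟨c, hc, h⟩ := hK.exists_forall_le' (f := l) (a := 0) hl.continuousOn fun x _ => hpos x
  exact ⟨c, hc, h⟩

namespace IsDegenerateElliptic

variable (hB : IsDegenerateElliptic B lam₁ lam₂)
include hB

lemma energy_nonneg (u : E d → ℝ) : 0 ≤ energy B u := hB.fieldForm_self_nonneg _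

/-- A sequence of test functions of bounded energy that tends to zero in mean square tends to zero
weakly for the form. The field `B ∇v` need not be smooth, but it is square integrable with compact
support `K`, hence approximable by smooth fields; on `K` the ellipticity is uniform, so that
the energy controls the gradients there. -/
lemma tendsto_fieldForm_gradient {u : ℕ → E d → ℝ} (hu : ∀ n, IsTest (u n)) {C : ℝ}
    (hC : ∀ᶠ n in atTop, energy B (u n) ≤ C)
    (h0 : Tendsto (fun n => ∫ x, u n x ^ 2) atTop (𝓝 0)) {v : E d → ℝ} (hv : IsTest v) :
    Tendsto (fun n => fieldForm B (gradient (u n)) (gradient v)) atTop (𝓝 0) := by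
  obtain ⟨χ, hχ, hχ1, hχ0, hχle⟩ := exists_cutoff hv.hasCompactSupport_gradient
  obtain ⟨c, hc, hcl⟩ := exists_pos_le_on_compact lam₁.continuous hB.pos hχ.2
  set Y : E d → E d := fun x => Matrix.toEuclideanLin (B x) (gradient v x) with hY
  have hY2 : MemLp Y 2 volume := hB.memLp_apply hv.memLp_gradient
  have hC0 : 0 ≤ C := by
    obtain ⟨n, hn⟩ := hC.exists
    exact (hB.energy_nonneg _).trans hn
  rw [Metric.tendsto_atTop]
  intro ε hε
  -- the error of approximating `B ∇v` is weighted with `√(C / c)`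
  obtain ⟨δ, hδ, hδε⟩ : ∃ δ, 0 < δ ∧ √(C / c) * δ < ε / 2 := by
    refine ⟨ε / 2 / (√(C / c) + 1), by positivity, ?_⟩
    rw [mul_div_assoc', div_lt_iff₀ (by positivity)]
    nlinarith [Real.sqrt_nonneg (C / c)]
  obtain ⟨Φ, hΦc, hΦ, hΦδ⟩ := hY2.exist_eLpNorm_sub_le (by norm_num) (by norm_num) hδ
  have hΦ2 : MemLp Φ 2 volume := hΦ.continuous.memLp_of_hasCompactSupport hΦc
  have hdiff : MemLp (fun x => ‖Y x - Φ x‖) 2 volume := (hY2.sub hΦ2).norm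
  have hdδ : √(∫ x, ‖Y x - Φ x‖ ^ 2) ≤ δ := by
    have h1 := eLpNorm_two_eq hdiff
    have h2 : eLpNorm (fun x => ‖Y x - Φ x‖) 2 volume = eLpNorm (Y - Φ) 2 volume :=
      eLpNorm_norm (Y - Φ)
    rw [h2] at h1
    rw [h1] at hΦδ
    exact (ENNReal.ofReal_le_ofReal_iff hδ.le).1 hΦδ
  have h2 := tendsto_integral_inner_gradient_smooth hu h0 (Ψ := χ • Φ) (hχ.1.smul hΦ)
    (hΦc.smul_left)
  have h3 : ∀ᶠ n in atTop, |∫ x, inner ℝ (gradient (u n) x) ((χ • Φ) x)| < ε / 2 := by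
    have := h2.abs
    rw [abs_zero] at this
    exact this.eventually (gt_mem_nhds (by positivity))
  refine eventually_atTop.1 ?_
  filter_upwards [h3, hC] with n hn hCn
  have hgn := (hu n).memLp_gradient
  have hχg : MemLp (fun x => χ x * ‖gradient (u n) x‖) 2 volume := by
    refine hgn.of_le_mul (c := 1) (hχ.continuous.aestronglyMeasurable.mul hgn.1.norm)
      (Eventually.of_forall fun x => ?_)
    simp only [norm_mul, Real.norm_eq_abs, abs_of_nonneg (hχ0 x), abs_norm]
    exact mul_le_mul_of_nonneg_right (hχle x) (norm_nonneg _)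
  have hχe : ∫ x, (χ x * ‖gradient (u n) x‖) ^ 2 ≤ C / c := by
    refine le_trans ?_ (div_le_div_of_nonneg_right hCn hc.le)
    rw [energy, fieldForm, ← integral_div]
    refine integral_mono_ae hχg.integrable_sq ((hB.integrable_pairing hgn hgn).div_const _) ?_
    filter_upwards [hB.lower, hB.pairing_nonneg] with x hx hx0
    rw [le_div_iff₀ hc]
    by_cases hxχ : x ∈ tsupport χ
    · refine le_trans ?_ (hx _)
      have h4 := hcl x hxχ
      have h5 : χ x ^ 2 ≤ 1 := pow_le_one₀ (hχ0 x) (hχle x)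
      calc (χ x * ‖gradient (u n) x‖) ^ 2 * c
          = (χ x ^ 2 * c) * ‖gradient (u n) x‖ ^ 2 := by ring
        _ ≤ (1 * lam₁ x) * ‖gradient (u n) x‖ ^ 2 := by gcongr
        _ = _ := by ring
    · simp [image_eq_zero_of_notMem_tsupport hxχ, hx0]
  have hχY : ∀ x, inner ℝ (gradient (u n) x) (Y x)
      = χ x * inner ℝ (gradient (u n) x) (Y x) := by
    intro x
    by_cases hx : x ∈ tsupport (gradient v)
    · simp [(hχ1 x hx).eq_of_nhds]
    · simp [hY, image_eq_zero_of_notMem_tsupport hx]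
  have hi1 : Integrable (fun x => χ x * inner ℝ (gradient (u n) x) (Y x - Φ x)) := by
    refine (hχg.integrable_mul hdiff).mono ?_ (Eventually.of_forall fun x => ?_)
    · exact hχ.continuous.aestronglyMeasurable.mul (hgn.1.inner (hY2.1.sub hΦ2.1))
    · simp only [norm_mul, Pi.mul_apply, mul_assoc, norm_norm]
      exact mul_le_mul_of_nonneg_left (norm_inner_le_norm _ _) (norm_nonneg _)
  have hi2 : Integrable (fun x => inner ℝ (gradient (u n) x) ((χ • Φ) x)) :=
    ((hu n).continuous_gradient.inner
      (hχ.continuous.smul hΦ.continuous)).integrable_of_hasCompactSupport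
      ((hu n).hasCompactSupport_gradient.mono' fun x hx => subset_tsupport _ fun h => hx (by
        simp [h]))
  have hsplit : fieldForm B (gradient (u n)) (gradient v)
      = (∫ x, χ x * inner ℝ (gradient (u n) x) (Y x - Φ x))
        + ∫ x, inner ℝ (gradient (u n) x) ((χ • Φ) x) := by
    rw [hB.fieldForm_comm, ← integral_add hi1 hi2]
    refine integral_congr_ae (Eventually.of_forall fun x => ?_)
    simp only [pairing]
    rw [real_inner_comm, hχY x]
    simp only [Pi.smul_apply', inner_sub_right, inner_smul_right]
    ring
  have h6 : |∫ x, χ x * inner ℝ (gradient (u n) x) (Y x - Φ x)| ≤ √(C / c) * δ := by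
    have h7 : |∫ x, χ x * inner ℝ (gradient (u n) x) (Y x - Φ x)|
        ≤ ∫ x, χ x * ‖gradient (u n) x‖ * ‖Y x - Φ x‖ := by
      refine abs_integral_le_integral_abs.trans
        (integral_mono hi1.abs (hχg.integrable_mul hdiff) fun x => ?_)
      simp only [abs_mul, abs_of_nonneg (hχ0 x), mul_assoc]
      exact mul_le_mul_of_nonneg_left (abs_real_inner_le_norm _ _) (hχ0 x)
    have h8 := Real.abs_le_sqrt (sq_integral_mul_le hχg hdiff)
    refine h7.trans ((le_abs_self _).trans (h8.trans ?_))
    rw [Real.sqrt_mul (integral_sq_nonneg _)]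
    exact mul_le_mul (Real.sqrt_le_sqrt hχe) hdδ (Real.sqrt_nonneg _) (Real.sqrt_nonneg _)
  rw [Real.dist_eq, sub_zero, hsplit]
  exact (abs_add_le _ _).trans_lt (by linarith)

lemma energy_add_le {u v : E d → ℝ} (hu : IsTest u) (hv : IsTest v) :
    energy B u ≤ 2 * energy B (u - v) + 2 * energy B v := by
  have h : gradient u = gradient (u - v) + gradient v := by
    rw [gradient_sub hu.differentiable hv.differentiable, sub_add_cancel]
  rw [energy, h]
  exact hB.fieldForm_add_self_le (hu.sub hv).memLp_gradient hv.memLp_gradient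

lemma energy_sub_le {u v : E d → ℝ} (hu : IsTest u) (hv : IsTest v) :
    energy B (u - v) ≤ 2 * energy B u + 2 * energy B v := by
  have h := hB.energy_add_le (hu.sub hv) hu
  rw [show u - v - u = -v by abel, energy, energy, gradient_neg] at h
  have h2 : fieldForm B (-gradient v) (-gradient v) = energy B v := by
    simp [fieldForm, energy, pairing_neg_left, pairing_neg_right]
  rw [h2] at h
  rw [energy, add_comm]
  exact h

lemma eventually_energy_le {u : ℕ → E d → ℝ} (hu : ∀ n, IsTest (u n))
    (hcau : Tendsto (fun p : ℕ × ℕ => energy B (u p.1 - u p.2)) atTop (𝓝 0)) :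
    ∃ C, ∀ᶠ n in atTop, energy B (u n) ≤ C := by
  obtain ⟨N, hN⟩ := (tendsto_atTop_prod_zero_iff fun m n => hB.energy_nonneg (u m - u n)).1
    hcau 1 one_pos
  refine ⟨2 + 2 * energy B (u N), eventually_atTop.2 ⟨N, fun n hn => ?_⟩⟩
  have := hB.energy_add_le (hu n) (hu N)
  have := hN n hn N le_rfl
  linarith

/-- Closability: a sequence of test functions that is Cauchy for the form and tends to zero
in mean square tends to zero for the form. -/
lemma tendsto_energy_zero {u : ℕ → E d → ℝ} (hu : ∀ n, IsTest (u n))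
    (hcau : Tendsto (fun p : ℕ × ℕ => energy B (u p.1 - u p.2)) atTop (𝓝 0))
    (h0 : Tendsto (fun n => ∫ x, u n x ^ 2) atTop (𝓝 0)) :
    Tendsto (fun n => energy B (u n)) atTop (𝓝 0) := by
  obtain ⟨C, hC⟩ := hB.eventually_energy_le hu hcau
  rw [Metric.tendsto_atTop]
  intro ε hε
  obtain ⟨N, hN⟩ := (tendsto_atTop_prod_zero_iff fun m n => hB.energy_nonneg (u m - u n)).1
    hcau (ε / 2) (by positivity)
  have h1 := (hB.tendsto_fieldForm_gradient hu hC h0 (hu N)).eventually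
    (gt_mem_nhds (show (0 : ℝ) < ε / 4 by positivity))
  refine eventually_atTop.1 ?_
  filter_upwards [h1, eventually_ge_atTop N] with n hn hnN
  rw [Real.dist_eq, sub_zero, abs_of_nonneg (hB.energy_nonneg _)]
  have h2 := hN n hnN N le_rfl
  have gn := (hu n).memLp_gradient
  have gN := (hu N).memLp_gradient
  rw [energy, gradient_sub (hu n).differentiable (hu N).differentiable,
    hB.fieldForm_sub_left gn gN (gn.sub gN), hB.fieldForm_sub_right gn gn gN,
    hB.fieldForm_sub_right gN gn gN, hB.fieldForm_comm (gradient (u N)) (gradient (u n))] at h2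
  have h3 := hB.energy_nonneg (u N)
  rw [energy] at h3 ⊢
  linarith

end IsDegenerateElliptic

/-! ### The closed form and its domain -/

lemma integral_sq_add_le {f g : E d → ℝ} (hf : MemLp f 2 volume) (hg : MemLp g 2 volume) :
    ∫ x, (f x + g x) ^ 2 ≤ 2 * (∫ x, f x ^ 2) + 2 * ∫ x, g x ^ 2 := by
  rw [← integral_const_mul, ← integral_const_mul,
    ← integral_add (hf.integrable_sq.const_mul _) (hg.integrable_sq.const_mul _)]
  refine integral_mono (hf.add hg).integrable_sq
    ((hf.integrable_sq.const_mul _).add (hg.integrable_sq.const_mul _)) fun x => ?_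
  change (f x + g x) ^ 2 ≤ 2 * f x ^ 2 + 2 * g x ^ 2
  nlinarith [sq_nonneg (f x - g x)]

/-- A Lipschitz function of a function changes the mean square distance at most by a factor. -/
lemma integral_sq_comp_sub_le {S : ℝ → ℝ} {L : ℝ}
    (hL : ∀ a b, |S a - S b| ≤ L * |a - b|) {f g : E d → ℝ} (hf : MemLp f 2 volume)
    (hg : MemLp g 2 volume) :
    ∫ x, (S (f x) - S (g x)) ^ 2 ≤ L ^ 2 * ∫ x, (f x - g x) ^ 2 := by
  rw [← integral_const_mul]
  refine integral_mono_of_nonneg (Eventually.of_forall fun x => sq_nonneg _)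
    ((hf.sub hg).integrable_sq.const_mul _) (Eventually.of_forall fun x => ?_)
  simp only
  rw [← mul_pow, ← sq_abs, ← sq_abs (L * _), abs_mul]
  refine pow_le_pow_left₀ (abs_nonneg _) ((hL _ _).trans ?_) 2
  exact mul_le_mul_of_nonneg_right (le_abs_self L) (abs_nonneg _)

lemma preForm_self (u : E d → ℝ) : preForm B u u = (1 / 2) * energy B u := rfl

lemma isApprox_iff {f : E d → ℝ} (hf : MemLp f 2 volume) {u : ℕ → E d → ℝ} :
    IsApprox B f u ↔ (∀ n, IsTest (u n)) ∧
      Tendsto (fun p : ℕ × ℕ => energy B (u p.1 - u p.2)) atTop (𝓝 0) ∧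
      Tendsto (fun n => ∫ x, (u n x - f x) ^ 2) atTop (𝓝 0) := by
  have h2 : Tendsto (fun p : ℕ × ℕ => preForm B (u p.1 - u p.2) (u p.1 - u p.2)) atTop (𝓝 0) ↔
      Tendsto (fun p : ℕ × ℕ => energy B (u p.1 - u p.2)) atTop (𝓝 0) := by
    simp_rw [preForm_self]
    constructor
    · intro h
      simpa using h.const_mul 2
    · intro h
      simpa only [mul_zero] using h.const_mul (1 / 2)
  constructor
  · intro h
    refine ⟨h.test, h2.1 h.cauchy, ?_⟩
    exact (tendsto_eLpNorm_two_iff fun n => (h.test n).memLp.sub hf).1 h.tendsto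
  · rintro ⟨ht, hc, hs⟩
    exact ⟨ht, h2.2 hc, (tendsto_eLpNorm_two_iff fun n => (ht n).memLp.sub hf).2 hs⟩

/-- A sequence converging in mean square is Cauchy in mean square. -/
lemma tendsto_integral_sq_sub {f : E d → ℝ} (hf : MemLp f 2 volume) {u : ℕ → E d → ℝ}
    (hu : ∀ n, MemLp (u n) 2 volume)
    (h : Tendsto (fun n => ∫ x, (u n x - f x) ^ 2) atTop (𝓝 0)) :
    Tendsto (fun p : ℕ × ℕ => ∫ x, (u p.1 x - u p.2 x) ^ 2) atTop (𝓝 0) := by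
  have h1 : Tendsto (fun p : ℕ × ℕ => 2 * (∫ x, (u p.1 x - f x) ^ 2)
      + 2 * ∫ x, (u p.2 x - f x) ^ 2) atTop (𝓝 0) := by
    rw [← prod_atTop_atTop_eq]
    simpa using ((h.comp tendsto_fst).const_mul 2).add ((h.comp tendsto_snd).const_mul 2)
  refine squeeze_zero (fun p => integral_sq_nonneg (fun x => u p.1 x - u p.2 x)) (fun p => ?_) h1
  have h3 := integral_sq_add_le ((hu p.1).sub hf) (hf.sub (hu p.2))
  simp only [Pi.sub_apply, sub_add_sub_cancel] at h3
  simpa only [sub_sq_comm (f _) (u p.2 _)] using h3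

namespace IsDegenerateElliptic

variable (hB : IsDegenerateElliptic B lam₁ lam₂)
include hB

lemma tendsto_fieldForm_zero {ι : Type*} {l : Filter ι} {X Y : ι → E d → E d} {C : ℝ}
    (hX : ∀ i, MemLp (X i) 2 volume) (hY : ∀ i, MemLp (Y i) 2 volume)
    (h0 : Tendsto (fun i => fieldForm B (X i) (X i)) l (𝓝 0))
    (hC : ∀ᶠ i in l, fieldForm B (Y i) (Y i) ≤ C) :
    Tendsto (fun i => fieldForm B (X i) (Y i)) l (𝓝 0) := by
  have h2 : Tendsto (fun i => √(fieldForm B (X i) (X i) * C)) l (𝓝 0) := by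
    simpa using (h0.mul_const C).sqrt
  refine squeeze_zero_norm' ?_ h2
  filter_upwards [hC] with i hi
  rw [Real.norm_eq_abs]
  apply Real.abs_le_sqrt
  exact (hB.sq_fieldForm_le (hX i) (hY i)).trans
    (mul_le_mul_of_nonneg_left hi (hB.fieldForm_self_nonneg _))

lemma tendsto_preForm_zero {ι : Type*} {l : Filter ι} {u v : ι → E d → ℝ} {C : ℝ}
    (hu : ∀ i, IsTest (u i)) (hv : ∀ i, IsTest (v i))
    (h0 : Tendsto (fun i => energy B (u i)) l (𝓝 0)) (hC : ∀ᶠ i in l, energy B (v i) ≤ C) :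
    Tendsto (fun i => preForm B (u i) (v i)) l (𝓝 0) := by
  simpa only [preForm_eq, mul_zero] using (hB.tendsto_fieldForm_zero (fun i => (hu i).memLp_gradient)
    (fun i => (hv i).memLp_gradient) h0 hC).const_mul (1 / 2)

lemma preForm_comm (u v : E d → ℝ) : preForm B u v = preForm B v u := by
  rw [preForm_eq, preForm_eq, hB.fieldForm_comm]

lemma preForm_sub_left {u v w : E d → ℝ} (hu : IsTest u) (hv : IsTest v) (hw : IsTest w) :
    preForm B (u - v) w = preForm B u w - preForm B v w := by
  rw [preForm_eq, gradient_sub hu.differentiable hv.differentiable,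
    hB.fieldForm_sub_left hu.memLp_gradient hv.memLp_gradient hw.memLp_gradient, mul_sub]
  rfl

lemma preForm_sub_right {u v w : E d → ℝ} (hu : IsTest u) (hv : IsTest v) (hw : IsTest w) :
    preForm B w (u - v) = preForm B w u - preForm B w v := by
  simp only [hB.preForm_comm w, hB.preForm_sub_left hu hv hw]

/-- Two approximating sequences of the same function are equivalent for the form. -/
lemma tendsto_energy_sub {f : E d → ℝ} (hf : MemLp f 2 volume) {u v : ℕ → E d → ℝ}
    (hu : IsApprox B f u) (hv : IsApprox B f v) :
    Tendsto (fun n => energy B (u n - v n)) atTop (𝓝 0) := by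
  obtain ⟨ut, uc, us⟩ := (isApprox_iff hf).1 hu
  obtain ⟨vt, vc, vs⟩ := (isApprox_iff hf).1 hv
  refine hB.tendsto_energy_zero (u := fun n => u n - v n) (fun n => (ut n).sub (vt n)) ?_ ?_
  · have h1 := (uc.const_mul 2).add (vc.const_mul 2)
    simp only [mul_zero, add_zero] at h1
    refine squeeze_zero (fun p => hB.energy_nonneg _) (fun p => ?_) h1
    rw [show u p.1 - v p.1 - (u p.2 - v p.2) = (u p.1 - u p.2) - (v p.1 - v p.2) by abel]
    exact hB.energy_sub_le ((ut _).sub (ut _)) ((vt _).sub (vt _))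
  · have h1 := (us.const_mul 2).add (vs.const_mul 2)
    simp only [mul_zero, add_zero] at h1
    refine squeeze_zero (fun n => integral_sq_nonneg (u n - v n)) (fun n => ?_) h1
    have h3 := integral_sq_add_le ((ut n).memLp.sub hf) (hf.sub (vt n).memLp)
    simp only [Pi.sub_apply, sub_add_sub_cancel] at h3
    simpa only [Pi.sub_apply, sub_sq_comm (f _) (v n _)] using h3

/-- The closed form is the limit of the form along arbitrary approximating sequences. -/
lemma tendsto_form {f g : E d → ℝ} (hf : MemLp f 2 volume) (hg : MemLp g 2 volume)
    {u v : ℕ → E d → ℝ} (hu : IsApprox B f u) (hv : IsApprox B g v) :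
    Tendsto (fun n => preForm B (u n) (v n)) atTop (𝓝 (form B f g)) := by
  have h : InDomain B f ∧ InDomain B g := ⟨⟨hf, u, hu⟩, ⟨hg, v, hv⟩⟩
  rw [form, dif_pos h]
  set u' := h.1.2.choose with hu'def
  set v' := h.2.2.choose with hv'def
  have hu' : IsApprox B f u' := h.1.2.choose_spec
  have hv' : IsApprox B g v' := h.2.2.choose_spec
  obtain ⟨ut, uc, us⟩ := (isApprox_iff hf).1 hu
  obtain ⟨vt, vc, vs⟩ := (isApprox_iff hg).1 hv
  obtain ⟨ut', uc', us'⟩ := (isApprox_iff hf).1 hu'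
  obtain ⟨vt', vc', vs'⟩ := (isApprox_iff hg).1 hv'
  obtain ⟨Cu', hCu'⟩ := hB.eventually_energy_le ut' uc'
  obtain ⟨Cv, hCv⟩ := hB.eventually_energy_le vt vc
  obtain ⟨Cv', hCv'⟩ := hB.eventually_energy_le vt' vc'
  have hcau : CauchySeq (fun n => preForm B (u' n) (v' n)) := by
    rw [cauchySeq_iff_tendsto_dist_atTop_0]
    have h1 := hB.tendsto_preForm_zero (u := fun p : ℕ × ℕ => u' p.1 - u' p.2)
      (v := fun p => v' p.1) (C := Cv') (fun p => (ut' _).sub (ut' _)) (fun p => vt' _) uc'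
      (by rw [← prod_atTop_atTop_eq]; exact tendsto_fst.eventually hCv')
    have h2 := hB.tendsto_preForm_zero (u := fun p : ℕ × ℕ => v' p.1 - v' p.2)
      (v := fun p => u' p.2) (C := Cu') (fun p => (vt' _).sub (vt' _)) (fun p => ut' _) vc'
      (by rw [← prod_atTop_atTop_eq]; exact tendsto_snd.eventually hCu')
    have h3 := (h1.add h2).abs
    simp only [add_zero, abs_zero] at h3
    refine h3.congr fun p => ?_
    rw [hB.preForm_comm (v' p.1 - v' p.2), hB.preForm_sub_left (ut' _) (ut' _) (vt' _),
      hB.preForm_sub_right (vt' _) (vt' _) (ut' _), Real.dist_eq]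
    congr 1
    ring
  have hlim := hcau.tendsto_limUnder
  have h1 := hB.tendsto_preForm_zero (fun n => (ut n).sub (ut' n)) vt
    (hB.tendsto_energy_sub hf hu hu') hCv
  have h2 := hB.tendsto_preForm_zero (fun n => (vt n).sub (vt' n)) ut'
    (hB.tendsto_energy_sub hg hv hv') hCu'
  have h3 := (h1.add h2).add hlim
  simp only [zero_add] at h3
  refine h3.congr fun n => ?_
  rw [hB.preForm_comm (v n - v' n), hB.preForm_sub_left (ut n) (ut' n) (vt n),
    hB.preForm_sub_right (vt n) (vt' n) (ut' n)]
  ring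

end IsDegenerateElliptic

/-! ### Operations on approximating sequences -/

lemma IsTest.isApprox {f : E d → ℝ} (hf : IsTest f) : IsApprox B f fun _ => f := by
  have : energy B 0 = 0 := by
    have : gradient (0 : E d → ℝ) = 0 := by
      simpa using gradient_sub hf.differentiable hf.differentiable
    simp [energy, fieldForm, this, pairing]
  refine (isApprox_iff hf.memLp).2 ⟨fun _ => hf, ?_, ?_⟩
  · simp [this]
  · simp

lemma IsTest.inDomain {f : E d → ℝ} (hf : IsTest f) : InDomain B f :=
  ⟨hf.memLp, _, hf.isApprox⟩

lemma IsTest.memLp_mul {φ f : E d → ℝ} (hφ : IsTest φ) (hf : MemLp f 2 volume) :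
    MemLp (φ * f) 2 volume :=
  hf.mul hφ.memLp_top

lemma IsApprox.neg {f : E d → ℝ} {u : ℕ → E d → ℝ} (hu : IsApprox B f u) :
    IsApprox B (-f) fun n => -u n := by
  have h : ∀ w : E d → ℝ, preForm B (-w) (-w) = preForm B w w := fun w => by
    simp [preForm, gradient_neg, pairing_neg_left, pairing_neg_right]
  refine ⟨fun n => (hu.test n).neg, hu.cauchy.congr fun p => ?_, hu.tendsto.congr fun n => ?_⟩
  · rw [← h, neg_sub, neg_sub_neg]
  · rw [← eLpNorm_neg, neg_sub, neg_sub_neg]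

lemma IsDegenerateElliptic.isApprox_mul (hB : IsDegenerateElliptic B lam₁ lam₂) {φ f : E d → ℝ}
    (hφ : IsTest φ) (hf : MemLp f 2 volume) {u : ℕ → E d → ℝ} (hu : IsApprox B f u) :
    IsApprox B (φ * f) fun n => φ * u n := by
  obtain ⟨ut, uc, us⟩ := (isApprox_iff hf).1 hu
  obtain ⟨C, hC, hφC⟩ := hφ.exists_bound
  obtain ⟨M, hM, hφM⟩ := hφ.exists_bound_gradient
  obtain ⟨K, hK, hwK⟩ := hB.exists_fieldForm_smul_self_le hφM
    hφ.continuous_gradient.aestronglyMeasurable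
  refine (isApprox_iff (hφ.memLp_mul hf)).2 ⟨fun n => hφ.mul (ut n), ?_, ?_⟩
  · have h1 := ((uc.const_mul (C ^ 2)).const_mul 2).add (((tendsto_integral_sq_sub hf
      (fun n => (ut n).memLp) us).const_mul K).const_mul 2)
    simp only [mul_zero, add_zero] at h1
    refine squeeze_zero (fun p => hB.energy_nonneg _) (fun p => ?_) h1
    have hw : IsTest (u p.1 - u p.2) := (ut _).sub (ut _)
    rw [← mul_sub, energy, gradient_mul hφ.differentiable hw.differentiable]
    have h2 : MemLp (φ • gradient (u p.1 - u p.2)) 2 volume :=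
      hw.memLp_gradient.smul hφ.memLp_top
    have h3 : MemLp ((u p.1 - u p.2) • gradient φ) 2 volume :=
      hφ.memLp_gradient.smul hw.memLp_top
    refine (hB.fieldForm_add_self_le h2 h3).trans (add_le_add ?_ ?_)
    · exact mul_le_mul_of_nonneg_left (hB.fieldForm_smul_self_le
        hφ.continuous.aestronglyMeasurable hφC hw.memLp_gradient) zero_le_two
    · exact mul_le_mul_of_nonneg_left (hwK _ hw.memLp) zero_le_two
  · have h1 := us.const_mul (C ^ 2)
    rw [mul_zero] at h1
    refine squeeze_zero (fun n => integral_sq_nonneg (φ * u n - φ * f)) (fun n => ?_) h1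
    rw [← integral_const_mul]
    refine integral_mono ((hφ.memLp_mul (ut n).memLp).sub (hφ.memLp_mul hf)).integrable_sq
      (((ut n).memLp.sub hf).integrable_sq.const_mul _) fun x => ?_
    have : |φ x| ^ 2 ≤ C ^ 2 := pow_le_pow_left₀ (abs_nonneg _) (hφC x) 2
    rw [sq_abs] at this
    simp only [Pi.mul_apply, ← mul_sub, mul_pow]
    exact mul_le_mul_of_nonneg_right this (sq_nonneg _)

lemma exists_lipschitz {S : ℝ → ℝ} (hS : ContDiff ℝ 1 S) (hc : HasCompactSupport S) :
    ∃ L, 0 ≤ L ∧ (∀ a b, |S a - S b| ≤ L * |a - b|) ∧ ∀ a, |deriv S a| ≤ L := by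
  obtain ⟨L, hL⟩ := hS.lipschitzWith_of_hasCompactSupport hc one_ne_zero
  exact ⟨L, L.2, fun a b => by simpa [Real.dist_eq] using hL.dist_le_mul a b,
    fun a => norm_deriv_le_of_lipschitz hL⟩

/-- Smooth functions with compact support and `S 0 = 0` operate on the domain of the form, and on
approximating sequences. As `S'` is Lipschitz, the differences `S'(uₘ) - S'(uₙ)` tend to zero
in mean square; this suffices against the bounded gradient of one fixed `u_N`, while
`∇uₙ - ∇u_N` is uniformly small in energy. -/
lemma IsDegenerateElliptic.isApprox_comp (hB : IsDegenerateElliptic B lam₁ lam₂) {f : E d → ℝ}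
    (hf : MemLp f 2 volume) {u : ℕ → E d → ℝ} (hu : IsApprox B f u) {S : ℝ → ℝ}
    (hS : ContDiff ℝ ∞ S) (hc : HasCompactSupport S) (h0 : S 0 = 0) :
    MemLp (S ∘ f) 2 volume ∧ IsApprox B (S ∘ f) fun n => S ∘ u n := by
  obtain ⟨ut, uc, us⟩ := (isApprox_iff hf).1 hu
  obtain ⟨L, hL0, hL, hL'⟩ := exists_lipschitz (hS.of_le (by simp)) hc
  have hS' : ContDiff ℝ ∞ (deriv S) := (contDiff_infty_iff_deriv.1 hS).2
  obtain ⟨L', hL'0, hLL, -⟩ := exists_lipschitz (hS'.of_le (by simp)) hc.deriv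
  have hSf : MemLp (S ∘ f) 2 volume := by
    refine hf.of_le_mul (c := L) (hS.continuous.comp_aestronglyMeasurable hf.1)
      (Eventually.of_forall fun x => ?_)
    simpa [h0] using hL (f x) 0
  refine ⟨hSf, (isApprox_iff hSf).2 ⟨fun n => (ut n).comp hS h0, ?_, ?_⟩⟩
  · refine (tendsto_atTop_prod_zero_iff (a := fun m n => energy B (S ∘ u m - S ∘ u n))
      fun m n => hB.energy_nonneg _).2 fun ε hε => ?_
    obtain ⟨δ, hδ, hδε⟩ : ∃ δ, 0 < δ ∧ (18 * L ^ 2) * δ < ε / 2 := by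
      refine ⟨ε / 2 / (18 * L ^ 2 + 1), by positivity, ?_⟩
      rw [mul_div_assoc', div_lt_iff₀ (by positivity)]
      nlinarith [sq_nonneg L]
    obtain ⟨N, hN⟩ := (tendsto_atTop_prod_zero_iff fun m n => hB.energy_nonneg (u m - u n)).1
      uc δ hδ
    obtain ⟨M, hM, hNM⟩ := (ut N).exists_bound_gradient
    obtain ⟨K, hK, hwK⟩ := hB.exists_fieldForm_smul_self_le hNM
      (ut N).continuous_gradient.aestronglyMeasurable
    have hsq := (tendsto_integral_sq_sub hf (fun n => (ut n).memLp) us).const_mul (4 * K * L' ^ 2)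
    rw [mul_zero] at hsq
    obtain ⟨N', hN'⟩ := (tendsto_atTop_prod_zero_iff
      (a := fun m n => 4 * K * L' ^ 2 * ∫ x, (u m x - u n x) ^ 2)
      fun m n => mul_nonneg (by positivity) (integral_sq_nonneg (u m - u n))).1 hsq (ε / 2)
      (by positivity)
    refine ⟨max N N', fun m hm n hn => ?_⟩
    have hmN := (le_max_left _ _).trans hm
    have hnN := (le_max_left _ _).trans hn
    have e1 := hN m hmN n hnN
    have e2 := hN n hnN N le_rfl
    have e3 := hN' m ((le_max_right _ _).trans hm) n ((le_max_right _ _).trans hn)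
    set α : E d → ℝ := fun x => deriv S (u m x) with hα
    set β : E d → ℝ := fun x => deriv S (u m x) - deriv S (u n x) with hβ
    have hαc : Continuous α := hS'.continuous.comp (ut m).continuous
    have hβc : Continuous β := hαc.sub (hS'.continuous.comp (ut n).continuous)
    have hβL : ∀ x, |β x| ≤ 2 * L := fun x =>
      (abs_sub _ _).trans (by linarith [hL' (u m x), hL' (u n x)])
    have hβ2 : MemLp β 2 volume := by
      refine ((ut m).memLp.sub (ut n).memLp).of_le_mul (c := L') hβc.aestronglyMeasurable
        (Eventually.of_forall fun x => hLL _ _)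
    have dm := (ut m).memLp_gradient
    have dn := (ut n).memLp_gradient
    have dN := (ut N).memLp_gradient
    have bdd : ∀ {γ : E d → ℝ} {C : ℝ} {X : E d → E d}, Continuous γ → (∀ x, |γ x| ≤ C) →
        MemLp X 2 volume → MemLp (γ • X) 2 volume := by
      intro γ C X hγ hγC hX
      refine hX.of_le_mul (c := C) (hγ.aestronglyMeasurable.smul hX.1)
        (Eventually.of_forall fun x => ?_)
      simp only [Pi.smul_apply', norm_smul, Real.norm_eq_abs]
      exact mul_le_mul_of_nonneg_right (hγC x) (norm_nonneg _)
    have hgrad : gradient (S ∘ u m - S ∘ u n)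
        = α • (gradient (u m) - gradient (u n)) + (β • (gradient (u n) - gradient (u N))
          + β • gradient (u N)) := by
      have hSd : Differentiable ℝ S := hS.differentiable (by simp)
      rw [gradient_sub (hSd.comp (ut m).differentiable) (hSd.comp (ut n).differentiable),
        gradient_comp (ut m).differentiable hSd, gradient_comp (ut n).differentiable hSd]
      funext x
      simp only [hα, hβ, Pi.sub_apply, Pi.add_apply, Pi.smul_apply', smul_sub, sub_smul]
      abel
    rw [energy, gradient_sub (ut m).differentiable (ut n).differentiable] at e1
    rw [energy, gradient_sub (ut n).differentiable (ut N).differentiable] at e2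
    rw [energy, hgrad]
    have f1 := hB.fieldForm_smul_self_le hαc.aestronglyMeasurable (fun x => hL' (u m x))
      (dm.sub dn)
    have f2 := hB.fieldForm_smul_self_le hβc.aestronglyMeasurable hβL (dn.sub dN)
    have f3 := hwK β hβ2
    have f4 : ∫ x, β x ^ 2 ≤ L' ^ 2 * ∫ x, (u m x - u n x) ^ 2 :=
      integral_sq_comp_sub_le hLL (ut m).memLp (ut n).memLp
    have g1 := hB.fieldForm_add_self_le (bdd hαc (fun x => hL' (u m x)) (dm.sub dn))
      ((bdd hβc hβL (dn.sub dN)).add (bdd hβc hβL dN))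
    have g2 := hB.fieldForm_add_self_le (bdd hβc hβL (dn.sub dN)) (bdd hβc hβL dN)
    have k1 := mul_le_mul_of_nonneg_left e1.le (sq_nonneg L)
    have k2 := mul_le_mul_of_nonneg_left e2.le (sq_nonneg (2 * L))
    have k3 := mul_le_mul_of_nonneg_left f4 hK
    nlinarith
  · have h1 := us.const_mul (L ^ 2)
    rw [mul_zero] at h1
    exact squeeze_zero (fun n => integral_sq_nonneg (S ∘ u n - S ∘ f))
      (fun n => integral_sq_comp_sub_le hL (ut n).memLp hf) h1

/-! ### Energy measures with a density -/

/-- The measure `⟨B X, X⟩ dx` of a vector field `X`; for `X = ∇u` it is the energy measure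
of `u`. -/
noncomputable def fieldMeasure (B : E d → Matrix (Fin d) (Fin d) ℝ) (X : E d → E d) :
    Measure (E d) :=
  volume.withDensity fun x => ENNReal.ofReal (pairing (B x) (X x) (X x))

namespace IsDegenerateElliptic

variable (hB : IsDegenerateElliptic B lam₁ lam₂)
include hB

/-- The carré du champ identity on test functions: the derivatives of the weight `ψ` cancel. -/
lemma two_mul_preForm_sub {u ψ : E d → ℝ} (hu : IsTest u) (hψ : IsTest ψ) :
    2 * preForm B u (ψ * u) - preForm B (u * u) ψ
      = ∫ x, ψ x * pairing (B x) (gradient u x) (gradient u x) := by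
  have h1 := hB.integrable_pairing hu.memLp_gradient (hψ.mul hu).memLp_gradient
  have h2 := hB.integrable_pairing (hu.mul hu).memLp_gradient hψ.memLp_gradient
  rw [preForm, preForm, ← mul_assoc, ← integral_const_mul, ← integral_const_mul,
    ← integral_sub (h1.const_mul _) (h2.const_mul _)]
  refine integral_congr_ae (Eventually.of_forall fun x => ?_)
  simp only [gradient_mul hψ.differentiable hu.differentiable,
    gradient_mul hu.differentiable hu.differentiable, Pi.add_apply, Pi.smul_apply',
    pairing_add_left, pairing_add_right, pairing_smul_left, pairing_smul_right]
  ring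

lemma aemeasurable_pairing {X : E d → E d} (hX : AEStronglyMeasurable X volume) :
    AEMeasurable (fun x => ENNReal.ofReal (pairing (B x) (X x) (X x))) volume :=
  (hB.aestronglyMeasurable_pairing hX hX).aemeasurable.ennreal_ofReal

lemma integral_fieldMeasure {X : E d → E d} (hX : AEStronglyMeasurable X volume) (φ : E d → ℝ) :
    ∫ x, φ x ∂(fieldMeasure B X) = ∫ x, φ x * pairing (B x) (X x) (X x) := by
  rw [fieldMeasure, integral_withDensity_eq_integral_toReal_smul₀ (hB.aemeasurable_pairing hX)
    (Eventually.of_forall fun _ => ENNReal.ofReal_lt_top)]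
  refine integral_congr_ae ?_
  filter_upwards [hB.pairing_nonneg] with x hx
  rw [ENNReal.toReal_ofReal (hx _), smul_eq_mul, mul_comm]

lemma isLocallyFiniteMeasure_fieldMeasure {X : E d → E d} {M : ℝ} (hM : ∀ x, ‖X x‖ ≤ M) :
    IsLocallyFiniteMeasure (fieldMeasure B X) := by
  obtain ⟨C, hC, hl⟩ := hB.exists_bound
  have h : fieldMeasure B X ≤ (C * M ^ 2).toNNReal • volume := by
    have h2 : fieldMeasure B X ≤ volume.withDensity fun _ => ENNReal.ofReal (C * M ^ 2) := by
      refine withDensity_mono ?_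
      filter_upwards [hB.upper] with x hx
      refine ENNReal.ofReal_le_ofReal ((hx _).trans (mul_le_mul (hl x) ?_ (sq_nonneg _) hC.le))
      exact pow_le_pow_left₀ (norm_nonneg _) (hM x) 2
    rwa [withDensity_const] at h2
  exact Measure.isLocallyFiniteMeasure_of_le h

/-- The energy measure of a test function `g` is `⟨B ∇g, ∇g⟩ dx`. -/
lemma isEnergyMeasureBdd_of_isTest {g : E d → ℝ} (hg : IsTest g) :
    IsEnergyMeasureBdd B g (fieldMeasure B (gradient g)) := by
  obtain ⟨M, hM, hgM⟩ := hg.exists_bound_gradient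
  obtain ⟨C, hC, hl⟩ := hB.exists_bound
  refine ⟨hg.inDomain, hg.memLp_top, hB.isLocallyFiniteMeasure_fieldMeasure hgM, ?_⟩
  rintro φ ⟨hφ, v, hv⟩ - -
  rw [hB.integral_fieldMeasure hg.memLp_gradient.1]
  have h1 := hB.tendsto_form hg.memLp (hg.memLp_mul hφ) hg.isApprox (hB.isApprox_mul hg hφ hv)
  have h2 := hB.tendsto_form (hg.mul hg).memLp hφ (hg.mul hg).isApprox hv
  have h3 := (h1.const_mul 2).sub h2
  rw [mul_comm φ g]
  have hq : MemLp (fun x => pairing (B x) (gradient g x) (gradient g x)) 2 volume := by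
    refine hg.memLp_gradient.of_le_mul (c := C * M)
      (hB.aestronglyMeasurable_pairing hg.memLp_gradient.1 hg.memLp_gradient.1) ?_
    filter_upwards [hB.upper, hB.pairing_nonneg] with x hx hx0
    rw [Real.norm_eq_abs, abs_of_nonneg (hx0 _)]
    calc pairing (B x) (gradient g x) (gradient g x) ≤ lam₂ x * ‖gradient g x‖ ^ 2 := hx _
      _ ≤ C * ‖gradient g x‖ ^ 2 := by gcongr; exact hl x
      _ = C * ‖gradient g x‖ * ‖gradient g x‖ := by ring
      _ ≤ C * M * ‖gradient g x‖ := by gcongr; exact hgM x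
  obtain ⟨vt, -, vs⟩ := (isApprox_iff hφ).1 hv
  refine tendsto_nhds_unique (tendsto_integral_mul hφ hq (fun n => (vt n).memLp) vs)
    (h3.congr fun n => ?_)
  rw [mul_comm g (v n), hB.two_mul_preForm_sub hg (vt n)]

lemma form_zero : form B 0 0 = 0 := by
  have h := hB.tendsto_form (isTest_zero (d := d)).memLp isTest_zero.memLp
    isTest_zero.isApprox isTest_zero.isApprox
  refine tendsto_nhds_unique h ?_
  have : gradient (0 : E d → ℝ) = 0 := by
    simpa using gradient_sub (isTest_zero (d := d)).differentiable isTest_zero.differentiable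
  simp [preForm, this, pairing]

lemma isEnergyMeasure_of_isTest {g : E d → ℝ} (hg : IsTest g) :
    IsEnergyMeasure B g (fieldMeasure B (gradient g)) := by
  have h := hB.isEnergyMeasureBdd_of_isTest hg
  refine ⟨h.domain, h.radon, fun _ => g, fun _ => _, fun _ => h, ?_, ?_,
    fun φ _ _ => tendsto_const_nhds⟩
  · simp [hB.form_zero]
  · simp

/-- The energy measure of a linear function is `⟨B e, e⟩ dx`. -/
lemma isEnergyMeasureLoc_inner (e : E d) :
    IsEnergyMeasureLoc B (fun x => inner ℝ e x) (fieldMeasure B fun _ => e) := by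
  have hc : ContDiff ℝ ∞ (fun x : E d => (inner ℝ e x : ℝ)) := (innerSL ℝ e).contDiff
  refine ⟨hc.continuous.measurable, hB.isLocallyFiniteMeasure_fieldMeasure fun _ => le_rfl,
    fun K hK => ?_⟩
  obtain ⟨χ, hχ, hχ1, -, -⟩ := exists_cutoff hK
  set g : E d → ℝ := (fun x => inner ℝ e x) * χ with hg
  have hgt : IsTest g := IsTest.mul_left hc hχ
  have heq : ∀ x ∈ K, g =ᶠ[𝓝 x] fun x => inner ℝ e x := fun x hx => by
    filter_upwards [hχ1 x hx] with y hy
    simp [hg, hy]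
  refine ⟨g, fieldMeasure B (gradient g), ?_, hB.isEnergyMeasure_of_isTest hgt, ?_⟩
  · filter_upwards [ae_restrict_mem hK.measurableSet] with x hx
    exact (heq x hx).eq_of_nhds.symm
  · rw [fieldMeasure, fieldMeasure, restrict_withDensity isOpen_interior.measurableSet,
      restrict_withDensity isOpen_interior.measurableSet]
    refine withDensity_congr_ae ?_
    filter_upwards [ae_restrict_mem isOpen_interior.measurableSet] with x hx
    have : gradient g x = e := by
      rw [(heq x (interior_subset hx)).gradient_eq, gradient_inner_const]
    simp [this]

/-- Linear functions of small slope are admissible. -/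
lemma inner_mem_admissible {e : E d} {C : ℝ} (hl : ∀ x, lam₂ x ≤ C) (he : C * ‖e‖ ^ 2 ≤ 1) :
    (fun x => inner ℝ e x) ∈ admissible B := by
  refine ⟨(innerSL ℝ e).continuous, _, hB.isEnergyMeasureLoc_inner e,
    withDensity_absolutelyContinuous _ _, ?_⟩
  filter_upwards [Measure.rnDeriv_withDensity₀ volume
    (hB.aemeasurable_pairing (X := fun _ => e) aestronglyMeasurable_const), hB.upper] with x hx hu
  rw [fieldMeasure, hx, ENNReal.ofReal_le_one]
  exact (hu e).trans ((mul_le_mul_of_nonneg_right (hl x) (sq_nonneg _)).trans he)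

end IsDegenerateElliptic

/-! ### Admissible functions are Lipschitz -/

/-- The bound on the distributional derivatives of `f` by the measure `μ` that the energy measure
of `f` satisfies. Only `f` in mean square and `μ` as a functional on test functions enter, which
makes it stable under the limits and localizations that define energy measures. -/
def DerivBound (lam₁ f : E d → ℝ) (μ : Measure (E d)) : Prop :=
  ∀ φ : E d → ℝ, IsTest φ → (∀ x, 0 ≤ φ x) →
    ∀ c : ℝ, 0 < c → (∀ x ∈ tsupport φ, c ≤ lam₁ x) → ∀ e : E d, ‖e‖ ≤ 1 →
      (∫ x, f x * fderiv ℝ φ x e) ^ 2 ≤ c⁻¹ * (∫ x, φ x) * ∫ x, φ x ∂μ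

lemma IsTest.memLp_fderiv {φ : E d → ℝ} (hφ : IsTest φ) (e : E d) :
    MemLp (fun x => fderiv ℝ φ x e) 2 volume :=
  ((hφ.1.continuous_fderiv (by simp)).clm_apply
    continuous_const).memLp_of_hasCompactSupport (hφ.2.fderiv_apply (𝕜 := ℝ) e)

/-- A smooth compactly supported function that is `t ^ 2` on `[-M, M]`. -/
lemma exists_truncated_sq {M : ℝ} (hM : 0 ≤ M) :
    ∃ S : ℝ → ℝ, ContDiff ℝ ∞ S ∧ HasCompactSupport S ∧
      ∀ t, |t| ≤ M → S t = t ^ 2 ∧ deriv S t = 2 * t := by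
  let b : ContDiffBump (0 : ℝ) := ⟨M + 1, M + 2, by linarith, by linarith⟩
  refine ⟨fun t => t ^ 2 * b t, (contDiff_id.pow 2).mul b.contDiff,
    b.hasCompactSupport.mul_left, fun t ht => ?_⟩
  have h : (fun t => t ^ 2 * b t) =ᶠ[𝓝 t] fun t => t ^ 2 := by
    have : t ∈ Metric.ball (0 : ℝ) b.rIn := by
      rw [mem_ball_zero_iff, Real.norm_eq_abs]
      exact ht.trans_lt (lt_add_one M)
    filter_upwards [b.eventuallyEq_one_of_mem_ball this] with s hs
    simp [hs]
  exact ⟨h.eq_of_nhds, by rw [h.deriv_eq]; simp⟩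

namespace IsDegenerateElliptic

variable (hB : IsDegenerateElliptic B lam₁ lam₂)
include hB

/-- The energy measure of a bounded function `f` is the vague limit of the energy measures of
approximating test functions `uₙ`. The square of `f` is approximated by `S ∘ uₙ` with a truncation
`S` of `t ↦ t ^ 2`, and `2 uₙ - S' ∘ uₙ` tends to zero in mean square. -/
lemma tendsto_integral_energy {f : E d → ℝ} {μ : Measure (E d)} (h : IsEnergyMeasureBdd B f μ)
    {u : ℕ → E d → ℝ} (hu : IsApprox B f u) {φ : E d → ℝ} (hφ : IsTest φ) :
    Tendsto (fun n => ∫ x, φ x * pairing (B x) (gradient (u n) x) (gradient (u n) x)) atTop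
      (𝓝 (∫ x, φ x ∂μ)) := by
  have hf := h.domain.1
  obtain ⟨ut, uc, us⟩ := (isApprox_iff hf).1 hu
  obtain ⟨C, hC⟩ := hB.eventually_energy_le ut uc
  obtain ⟨M, hM0, hM⟩ : ∃ M, 0 ≤ M ∧ ∀ᵐ x, |f x| ≤ M := by
    refine ⟨(eLpNorm f ⊤ volume).toReal, ENNReal.toReal_nonneg, ?_⟩
    filter_upwards [ae_le_eLpNormEssSup (f := f) (μ := volume)] with x hx
    have h1 := ENNReal.toReal_mono h.bounded.eLpNorm_ne_top (eLpNorm_exponent_top (f := f) ▸ hx)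
    simpa using h1
  obtain ⟨S, hS, hSc, hSM⟩ := exists_truncated_sq hM0
  have hS0 : S 0 = 0 := by simpa using (hSM 0 (by simpa using hM0)).1
  have hS' : ContDiff ℝ ∞ (deriv S) := (contDiff_infty_iff_deriv.1 hS).2
  obtain ⟨L, hL0, hL, -⟩ := exists_lipschitz (hS'.of_le (by simp)) hSc.deriv
  obtain ⟨hSf, hSu⟩ := hB.isApprox_comp hf hu hS hSc hS0
  have hae : S ∘ f =ᵐ[volume] f * f := by
    filter_upwards [hM] with x hx
    simp [(hSM _ hx).1, pow_two]
  have hff : MemLp (f * f) 2 volume := hSf.ae_eq hae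
  have hffu : IsApprox B (f * f) fun n => S ∘ u n :=
    ⟨hSu.test, hSu.cauchy, hSu.tendsto.congr fun n =>
      eLpNorm_congr_ae ((EventuallyEq.refl _ _).sub hae)⟩
  rw [h.integral_eq φ hφ.inDomain hφ.continuous hφ.2]
  have t1 := hB.tendsto_form hf (hφ.memLp_mul hf) hu (hB.isApprox_mul hφ hf hu)
  have t2 := hB.tendsto_form hff hφ.memLp hffu hφ.isApprox
  -- `W` vanishes on the range of `f`
  set W : ℝ → ℝ := fun t => 2 * t - deriv S t with hW
  have hWL : ∀ a b, |W a - W b| ≤ (2 + L) * |a - b| := by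
    intro a b
    have e : W a - W b = 2 * (a - b) - (deriv S a - deriv S b) := by simp only [hW]; ring
    rw [e]
    refine (abs_sub _ _).trans ?_
    rw [abs_mul, abs_two]
    linarith [hL a b]
  have hW0 : W 0 = 0 := by simp [hW, (hSM 0 (by simpa using hM0)).2]
  have hWc : Continuous W := (continuous_const.mul continuous_id).sub hS'.continuous
  have hWu : ∀ n, MemLp (fun x => W (u n x)) 2 volume := fun n => by
    refine (ut n).memLp.of_le_mul (c := 2 + L)
      (hWc.comp (ut n).continuous).aestronglyMeasurable (Eventually.of_forall fun x => ?_)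
    simpa [hW0] using hWL (u n x) 0
  have hWs : Tendsto (fun n => ∫ x, W (u n x) ^ 2) atTop (𝓝 0) := by
    have h1 := us.const_mul ((2 + L) ^ 2)
    rw [mul_zero] at h1
    refine squeeze_zero (fun n => integral_sq_nonneg fun x => W (u n x)) (fun n => ?_) h1
    refine le_trans (le_of_eq (integral_congr_ae ?_))
      (integral_sq_comp_sub_le hWL (ut n).memLp hf)
    filter_upwards [hM] with x hx
    simp [hW, (hSM _ hx).2]
  obtain ⟨N, hN, hφN⟩ := hφ.exists_bound_gradient
  obtain ⟨K, hK, hwK⟩ := hB.exists_fieldForm_smul_self_le hφN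
    hφ.continuous_gradient.aestronglyMeasurable
  have hWφ : ∀ n, MemLp ((fun x => W (u n x)) • gradient φ) 2 volume := fun n =>
    (hφ.continuous_gradient.memLp_top_of_hasCompactSupport
      hφ.hasCompactSupport_gradient volume).smul (hWu n)
  have t3 : Tendsto (fun n => fieldForm B ((fun x => W (u n x)) • gradient φ) (gradient (u n)))
      atTop (𝓝 0) := by
    refine hB.tendsto_fieldForm_zero hWφ (fun n => (ut n).memLp_gradient) ?_ hC
    have h1 := hWs.const_mul K
    rw [mul_zero] at h1
    exact squeeze_zero (fun n => hB.fieldForm_self_nonneg _) (fun n => hwK _ (hWu n)) h1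
  have t4 := ((t1.const_mul 2).sub t2).sub (t3.const_mul (1 / 2))
  rw [mul_zero, sub_zero] at t4
  refine t4.congr fun n => ?_
  rw [← hB.two_mul_preForm_sub (ut n) hφ, sub_sub]
  congr 1
  have hSd : Differentiable ℝ S := hS.differentiable (by simp)
  have i1 := hB.integrable_pairing ((ut n).comp hS hS0).memLp_gradient hφ.memLp_gradient
  have i2 := hB.integrable_pairing (hWφ n) (ut n).memLp_gradient
  rw [preForm, preForm, fieldForm, ← mul_add, ← integral_add i1 i2]
  congr 1
  refine integral_congr_ae ?_
  filter_upwards [hB.symm] with x hx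
  simp only [gradient_comp (ut n).differentiable hSd,
    gradient_mul (ut n).differentiable (ut n).differentiable, Pi.add_apply, Pi.smul_apply',
    pairing_add_left, pairing_smul_left, pairing_comm hx (gradient φ x), hW]
  ring

/-- On test functions the derivative bound is the Cauchy–Schwarz inequality after an integration
by parts. -/
lemma sq_integral_mul_fderiv_le {u φ : E d → ℝ} (hu : IsTest u) (hφ : IsTest φ)
    (hφ0 : ∀ x, 0 ≤ φ x) {c : ℝ} (hc : 0 < c) (hcl : ∀ x ∈ tsupport φ, c ≤ lam₁ x) {e : E d}
    (he : ‖e‖ ≤ 1) :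
    (∫ x, u x * fderiv ℝ φ x e) ^ 2
      ≤ c⁻¹ * (∫ x, φ x) * ∫ x, φ x * pairing (B x) (gradient u x) (gradient u x) := by
  have hcu : Continuous (fun x => fderiv ℝ u x e) :=
    (hu.1.continuous_fderiv (by simp)).clm_apply continuous_const
  have hs : Continuous (fun x => √(φ x)) := Real.continuous_sqrt.comp hφ.continuous
  have hsc : HasCompactSupport (fun x => √(φ x)) := hφ.2.comp_left Real.sqrt_zero
  have m1 : MemLp (fun x => √(φ x)) 2 volume := hs.memLp_of_hasCompactSupport hsc
  have m2 : MemLp (fun x => √(φ x) * fderiv ℝ u x e) 2 volume :=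
    (hs.mul hcu).memLp_of_hasCompactSupport hsc.mul_right
  have h1 := sq_integral_mul_le m1 m2
  have e1 : ∫ x, √(φ x) * (√(φ x) * fderiv ℝ u x e) = -∫ x, u x * fderiv ℝ φ x e := by
    rw [← hu.integral_fderiv_mul hφ]
    refine integral_congr_ae (Eventually.of_forall fun x => ?_)
    simp only
    rw [← mul_assoc, Real.mul_self_sqrt (hφ0 x), mul_comm]
  have e2 : ∫ x, √(φ x) ^ 2 = ∫ x, φ x :=
    integral_congr_ae (Eventually.of_forall fun x => Real.sq_sqrt (hφ0 x))
  rw [e1, e2, neg_sq] at h1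
  refine h1.trans ?_
  rw [mul_comm c⁻¹, mul_assoc]
  refine mul_le_mul_of_nonneg_left ?_ (integral_nonneg hφ0)
  rw [← integral_const_mul]
  have hg := hu.memLp_gradient
  have i1 : Integrable (fun x => φ x * pairing (B x) (gradient u x) (gradient u x)) := by
    have := hB.integrable_pairing (hg.smul hφ.memLp_top : MemLp (φ • gradient u) 2 volume) hg
    simpa [pairing_smul_left] using this
  refine integral_mono_ae m2.integrable_sq (i1.const_mul _) ?_
  filter_upwards [hB.lower] with x hx
  rw [mul_pow, Real.sq_sqrt (hφ0 x), ← inner_gradient_left]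
  by_cases hxφ : x ∈ tsupport φ
  · have h2 : (inner ℝ (gradient u x) e) ^ 2 ≤ ‖gradient u x‖ ^ 2 := by
      rw [← sq_abs]
      refine pow_le_pow_left₀ (abs_nonneg _) ((abs_real_inner_le_norm _ _).trans ?_) 2
      exact mul_le_of_le_one_right (norm_nonneg _) he
    have h3 := (mul_le_mul_of_nonneg_right (hcl x hxφ) (sq_nonneg _)).trans (hx (gradient u x))
    rw [mul_left_comm]
    refine mul_le_mul_of_nonneg_left (h2.trans ?_) (hφ0 x)
    rwa [← div_eq_inv_mul, le_div_iff₀ hc, mul_comm]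
  · simp [image_eq_zero_of_notMem_tsupport hxφ]

lemma derivBound_of_isEnergyMeasureBdd {f : E d → ℝ} {μ : Measure (E d)}
    (h : IsEnergyMeasureBdd B f μ) : DerivBound lam₁ f μ := by
  intro φ hφ hφ0 c hc hcl e he
  obtain ⟨hf, u, hu⟩ := h.domain
  obtain ⟨ut, -, us⟩ := (isApprox_iff hf).1 hu
  exact le_of_tendsto_of_tendsto'
    ((tendsto_integral_mul hf (hφ.memLp_fderiv e) (fun n => (ut n).memLp) us).pow 2)
    ((hB.tendsto_integral_energy h hu hφ).const_mul _)
    fun n => hB.sq_integral_mul_fderiv_le (ut n) hφ hφ0 hc hcl he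

lemma derivBound_of_isEnergyMeasure {f : E d → ℝ} {μ : Measure (E d)}
    (h : IsEnergyMeasure B f μ) : DerivBound lam₁ f μ := by
  intro φ hφ hφ0 c hc hcl e he
  obtain ⟨g, ν, hgν, -, hgf, hν⟩ := h.approx
  have hg : ∀ n, MemLp (g n) 2 volume := fun n => (hgν n).domain.1
  exact le_of_tendsto_of_tendsto'
    ((tendsto_integral_mul h.domain.1 (hφ.memLp_fderiv e) hg
      ((tendsto_eLpNorm_two_iff fun n => (hg n).sub h.domain.1).1 hgf)).pow 2)
    ((hν φ hφ.continuous hφ.2).const_mul _)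
    fun n => hB.derivBound_of_isEnergyMeasureBdd (hgν n) φ hφ hφ0 c hc hcl e he

lemma derivBound_of_isEnergyMeasureLoc {f : E d → ℝ} {μ : Measure (E d)}
    (h : IsEnergyMeasureLoc B f μ) : DerivBound lam₁ f μ := by
  intro φ hφ hφ0 c hc hcl e he
  obtain ⟨K, hK, hφK⟩ := exists_compact_superset hφ.2.isCompact
  obtain ⟨g, ν, hfg, hgν, hμν⟩ := h.local_eq K hK
  have hb := hB.derivBound_of_isEnergyMeasure hgν φ hφ hφ0 c hc hcl e he
  have e1 : ∫ x, f x * fderiv ℝ φ x e = ∫ x, g x * fderiv ℝ φ x e := by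
    refine integral_congr_ae ?_
    filter_upwards [(ae_restrict_iff' hK.measurableSet).1 hfg] with x hx
    by_cases hxK : x ∈ K
    · rw [hx hxK]
    · have : fderiv ℝ φ x = 0 := image_eq_zero_of_notMem_tsupport fun h =>
        hxK (interior_subset (hφK (tsupport_fderiv_subset ℝ h)))
      simp [this]
  have e2 : ∀ ρ : Measure (E d), ∫ x, φ x ∂ρ = ∫ x in interior K, φ x ∂ρ := fun ρ =>
    (setIntegral_eq_integral_of_forall_compl_eq_zero fun x hx =>
      image_eq_zero_of_notMem_tsupport fun h => hx (hφK h)).symm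
  rw [e1, e2 μ, hμν, ← e2 ν]
  exact hb

lemma abs_integral_mul_fderiv_le {f : E d → ℝ} (hf : f ∈ admissible B) {φ : E d → ℝ}
    (hφ : IsTest φ) (hφ0 : ∀ x, 0 ≤ φ x) {c : ℝ} (hc : 0 < c)
    (hcl : ∀ x ∈ tsupport φ, c ≤ lam₁ x) {e : E d} (he : ‖e‖ ≤ 1) :
    |∫ x, f x * fderiv ℝ φ x e| ≤ 1 / √c * ∫ x, φ x := by
  obtain ⟨-, μ, hμ, hac, hle⟩ := hf
  have := hμ.radon
  have hμle : μ ≤ volume := by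
    rw [← Measure.withDensity_rnDeriv_eq μ volume hac]
    refine (withDensity_mono hle).trans_eq ?_
    rw [withDensity_const, one_smul]
  have h0 : 0 ≤ ∫ x, φ x := integral_nonneg hφ0
  have h1 : ∫ x, φ x ∂μ ≤ ∫ x, φ x :=
    integral_mono_measure hμle (Eventually.of_forall hφ0) hφ.integrable
  have h2 := hB.derivBound_of_isEnergyMeasureLoc hμ φ hφ hφ0 c hc hcl e he
  refine abs_le_of_sq_le_sq (h2.trans ?_) (by positivity)
  rw [mul_pow, div_pow, Real.sq_sqrt hc.le, one_pow, one_div, pow_two, mul_assoc]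
  gcongr

open scoped Convolution in
/-- The mollification of an admissible function is Lipschitz along segments on a neighbourhood of
which `λ₁` is bounded below. -/
lemma abs_convolution_sub_le {f : E d → ℝ} (hf : f ∈ admissible B) {c : ℝ} (hc : 0 < c)
    {x y : E d} (b : ContDiffBump (0 : E d))
    (hcl : ∀ z ∈ segment ℝ x y, ∀ w ∈ Metric.closedBall z b.rOut, c ≤ lam₁ w) :
    |(b.normed volume ⋆[ContinuousLinearMap.lsmul ℝ ℝ, volume] f) x
      - (b.normed volume ⋆[ContinuousLinearMap.lsmul ℝ ℝ, volume] f) y| ≤ 1 / √c * ‖x - y‖ := by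
  set ρ : E d → ℝ := b.normed volume with hρ
  have hρc : ContDiff ℝ ∞ ρ := b.contDiff_normed
  have hρs : HasCompactSupport ρ := b.hasCompactSupport_normed
  have hfl : LocallyIntegrable f volume := hf.1.locallyIntegrable
  have hder : ∀ z, HasFDerivAt (ρ ⋆[ContinuousLinearMap.lsmul ℝ ℝ, volume] f)
      ((fderiv ℝ ρ ⋆[(ContinuousLinearMap.lsmul ℝ ℝ).precompL (E d), volume] f) z) z := fun z =>
    hρs.hasFDerivAt_convolution_left _ (hρc.of_le (by simp)) hfl z
  have hbound : ∀ z ∈ segment ℝ x y,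
      ‖(fderiv ℝ ρ ⋆[(ContinuousLinearMap.lsmul ℝ ℝ).precompL (E d), volume] f) z‖
        ≤ 1 / √c := by
    intro z hz
    -- the reflected mollifier centred at `z`
    set φ : E d → ℝ := fun t => ρ (z - t) with hφdef
    have hφsupp : tsupport φ ⊆ Metric.closedBall z b.rOut := by
      refine closure_minimal (fun t ht => ?_) Metric.isClosed_closedBall
      have h1 : z - t ∈ Function.support ρ := ht
      rw [hρ, b.support_normed_eq, mem_ball_zero_iff] at h1
      rw [Metric.mem_closedBall, dist_comm, dist_eq_norm]
      exact h1.le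
    have hφ : IsTest φ := ⟨hρc.comp (contDiff_const.sub contDiff_id),
      HasCompactSupport.of_support_subset_isCompact (isCompact_closedBall z b.rOut)
        ((subset_tsupport φ).trans hφsupp)⟩
    have hφ1 : ∫ t, φ t = 1 := by
      rw [hφdef, integral_sub_left_eq_self ρ volume z]
      exact b.integral_normed
    refine ContinuousLinearMap.opNorm_le_of_unit_norm (by positivity) fun e he => ?_
    have key := hB.abs_integral_mul_fderiv_le hf hφ (fun t => b.nonneg_normed _) hc
      (fun w hw => hcl z hz w (hφsupp hw)) he.le
    rw [hφ1, mul_one] at key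
    have hconv := (hρs.fderiv (𝕜 := ℝ)).convolutionExists_left
      ((ContinuousLinearMap.lsmul ℝ ℝ).precompL (E d)) (hρc.continuous_fderiv (by simp)) hfl z
    have e1 : (fderiv ℝ ρ ⋆[(ContinuousLinearMap.lsmul ℝ ℝ).precompL (E d), volume] f) z e
        = ∫ t, fderiv ℝ ρ t e * f (z - t) := by
      rw [convolution, ContinuousLinearMap.integral_apply hconv]
      rfl
    have e2 : ∫ t, fderiv ℝ ρ t e * f (z - t) = -∫ t, f t * fderiv ℝ φ t e := by
      rw [← integral_sub_left_eq_self (fun t => fderiv ℝ ρ t e * f (z - t)) volume z,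
        ← integral_neg]
      refine integral_congr_ae (Eventually.of_forall fun t => ?_)
      have h1 : HasFDerivAt φ ((fderiv ℝ ρ (z - t)).comp (-ContinuousLinearMap.id ℝ (E d))) t :=
        ((hρc.differentiable (by simp)) (z - t)).hasFDerivAt.comp t
          ((hasFDerivAt_id t).const_sub z)
      simp only [sub_sub_cancel, h1.fderiv, ContinuousLinearMap.comp_apply]
      simp [mul_comm]
    rw [e1, e2, norm_neg]
    exact key
  rw [← Real.norm_eq_abs]
  exact (convex_segment x y).norm_image_sub_le_of_norm_hasFDerivWithin_le
    (fun z _ => (hder z).hasFDerivWithinAt) hbound (right_mem_segment ℝ x y)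
    (left_mem_segment ℝ x y)

lemma sub_le_of_lt {f : E d → ℝ} (hf : f ∈ admissible B) {c : ℝ} (hc : 0 < c) {x y : E d}
    (hcl : ∀ z ∈ segment ℝ x y, c < lam₁ z) : f x - f y ≤ 1 / √c * ‖x - y‖ := by
  have hcomp : IsCompact (segment ℝ x y) := by
    rw [segment_eq_image_lineMap]
    exact isCompact_Icc.image AffineMap.lineMap_continuous
  obtain ⟨δ, hδ, hsub⟩ := hcomp.exists_cthickening_subset_open
    (isOpen_lt continuous_const lam₁.continuous) hcl
  let b : ℕ → ContDiffBump (0 : E d) := fun n =>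
    ⟨1 / ((n : ℝ) + 1) / 2, 1 / ((n : ℝ) + 1), by positivity, half_lt_self (by positivity)⟩
  have hb : Tendsto (fun n => (b n).rOut) atTop (𝓝 0) := tendsto_one_div_add_atTop_nhds_zero_nat
  have hlim := (ContDiffBump.convolution_tendsto_right_of_continuous (μ := volume) hb hf.1 x).sub
    (ContDiffBump.convolution_tendsto_right_of_continuous (μ := volume) hb hf.1 y)
  refine le_of_tendsto hlim ?_
  filter_upwards [hb.eventually (gt_mem_nhds hδ)] with n hn
  refine (le_abs_self _).trans (hB.abs_convolution_sub_le hf hc (b n) fun z hz w hw => ?_)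
  exact (hsub (Metric.mem_cthickening_of_dist_le w z δ _ hz
    ((Metric.mem_closedBall.1 hw).trans hn.le))).le

lemma sInf_pos {D : Set (E d)} (hD : Bornology.IsBounded D) (hne : D.Nonempty) :
    0 < sInf (lam₁ '' D) := by
  obtain ⟨c, hc, h⟩ := exists_pos_le_on_compact lam₁.continuous hB.pos hD.isCompact_closure
  refine hc.trans_le (le_csInf (hne.image _) ?_)
  rintro _ ⟨x, hx, rfl⟩
  exact h x (subset_closure hx)

lemma sub_le_of_segment_subset {f : E d → ℝ} (hf : f ∈ admissible B) {D : Set (E d)}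
    (hD : Bornology.IsBounded D) {x y : E d} (hxy : segment ℝ x y ⊆ D) :
    f x - f y ≤ 1 / √(sInf (lam₁ '' D)) * ‖x - y‖ := by
  have hm := hB.sInf_pos hD ⟨x, hxy (left_mem_segment ℝ x y)⟩
  set m := sInf (lam₁ '' D)
  have hlim : Tendsto (fun c => 1 / √c * ‖x - y‖) (𝓝[<] m) (𝓝 (1 / √m * ‖x - y‖)) := by
    have h : ContinuousAt (fun c => 1 / √c * ‖x - y‖) m :=
      (continuousAt_const.div Real.continuous_sqrt.continuousAt
        (Real.sqrt_pos.2 hm).ne').mul continuousAt_const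
    exact h.tendsto.mono_left nhdsWithin_le_nhds
  refine ge_of_tendsto hlim ?_
  filter_upwards [Ioo_mem_nhdsLT hm] with c hc
  refine hB.sub_le_of_lt hf hc.1 fun z hz => hc.2.trans_le (csInf_le ⟨0, ?_⟩ ⟨z, hxy hz, rfl⟩)
  rintro _ ⟨w, -, rfl⟩
  exact (hB.pos w).le

lemma intrinsicDist_le {D : Set (E d)} (hD : Bornology.IsBounded D) {x y : E d}
    (hxy : segment ℝ x y ⊆ D) :
    intrinsicDist B x y ≤ ((1 / √(sInf (lam₁ '' D)) * ‖x - y‖ : ℝ) : EReal) :=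
  iSup₂_le fun _ hf => EReal.coe_le_coe_iff.2 (hB.sub_le_of_segment_subset hf hD hxy)

/-! ### The intrinsic metric -/

omit hB in
lemma _root_.DegenerateForm.le_iSup_upper (lam₂ : E d →ᵇ ℝ) (x : E d) : lam₂ x ≤ ⨆ z, lam₂ z :=
  le_ciSup (f := fun z => lam₂ z) ⟨‖lam₂‖, by
    rintro _ ⟨z, rfl⟩
    exact (le_abs_self _).trans (lam₂.norm_coe_le_norm z)⟩ x

lemma iSup_upper_pos : 0 < ⨆ z, lam₂ z :=
  ((hB.pos 0).trans_le (hB.le 0)).trans_le (le_iSup_upper lam₂ 0)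

lemma le_intrinsicDist (x y : E d) :
    ((1 / √(⨆ z, lam₂ z) * ‖x - y‖ : ℝ) : EReal) ≤ intrinsicDist B x y := by
  have hC := hB.iSup_upper_pos
  set C := ⨆ z, lam₂ z
  set e : E d := (1 / √C * ‖x - y‖⁻¹) • (x - y) with he
  have hmem : (fun z => inner ℝ e z) ∈ admissible B := by
    refine hB.inner_mem_admissible (fun z => le_iSup_upper lam₂ z) ?_
    change C * ‖e‖ ^ 2 ≤ 1
    rw [he, norm_smul, Real.norm_of_nonneg (by positivity), mul_assoc, mul_pow, div_pow,
      Real.sq_sqrt hC.le, ← mul_assoc, one_pow, mul_one_div_cancel hC.ne', one_mul]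
    exact pow_le_one₀ (by positivity) (inv_mul_le_one)
  refine le_trans (le_of_eq ?_)
    (le_iSup₂ (f := fun f (_ : f ∈ admissible B) => ((f x - f y : ℝ) : EReal)) _ hmem)
  congr 1
  rw [← inner_sub_right, he, real_inner_smul_left, real_inner_self_eq_norm_sq]
  rcases eq_or_ne ‖x - y‖ 0 with h | h
  · simp [h]
  · field_simp

lemma form_neg_neg (f g : E d → ℝ) : form B (-f) (-g) = form B f g := by
  by_cases h : InDomain B f ∧ InDomain B g
  · obtain ⟨⟨hf, u, hu⟩, hg, v, hv⟩ := h
    refine tendsto_nhds_unique (hB.tendsto_form hf.neg hg.neg hu.neg hv.neg)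
      ((hB.tendsto_form hf hg hu hv).congr fun n => ?_)
    simp [preForm, gradient_neg, pairing_neg_left, pairing_neg_right]
  · have hneg : ∀ {w : E d → ℝ}, InDomain B w → InDomain B (-w) :=
      fun ⟨hw, u, hu⟩ => ⟨hw.neg, _, hu.neg⟩
    have h' : ¬(InDomain B (-f) ∧ InDomain B (-g)) := fun h' =>
      h ⟨neg_neg f ▸ hneg h'.1, neg_neg g ▸ hneg h'.2⟩
    rw [form, form, dif_neg h, dif_neg h']

lemma isEnergyMeasureBdd_neg {f : E d → ℝ} {μ : Measure (E d)}
    (h : IsEnergyMeasureBdd B f μ) : IsEnergyMeasureBdd B (-f) μ := by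
  obtain ⟨hf, u, hu⟩ := h.domain
  refine ⟨⟨hf.neg, _, hu.neg⟩, h.bounded.neg, h.radon, fun φ h1 h2 h3 => ?_⟩
  rw [h.integral_eq φ h1 h2 h3, mul_neg, neg_mul_neg, hB.form_neg_neg]

lemma isEnergyMeasure_neg {f : E d → ℝ} {μ : Measure (E d)}
    (h : IsEnergyMeasure B f μ) : IsEnergyMeasure B (-f) μ := by
  obtain ⟨hf, u, hu⟩ := h.domain
  obtain ⟨g, ν, h1, h2, h3, h4⟩ := h.approx
  have hn : ∀ n, -g n - -f = -(g n - f) := fun n => by abel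
  refine ⟨⟨hf.neg, _, hu.neg⟩, h.radon, fun n => -g n, ν,
    fun n => hB.isEnergyMeasureBdd_neg (h1 n), ?_, ?_, h4⟩
  · simpa only [hn, hB.form_neg_neg] using h2
  · simpa only [hn, eLpNorm_neg] using h3

lemma neg_mem_admissible {f : E d → ℝ} (hf : f ∈ admissible B) : -f ∈ admissible B := by
  obtain ⟨hc, μ, hμ, hac, hle⟩ := hf
  refine ⟨hc.neg, μ, ⟨hμ.measurable.neg, hμ.radon, fun K hK => ?_⟩, hac, hle⟩
  obtain ⟨g, ν, h1, h2, h3⟩ := hμ.local_eq K hK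
  refine ⟨-g, ν, ?_, hB.isEnergyMeasure_neg h2, h3⟩
  filter_upwards [h1] with x hx
  simp [hx]

lemma intrinsicDist_comm_le (x y : E d) : intrinsicDist B x y ≤ intrinsicDist B y x := by
  refine iSup₂_le fun f hf => le_trans (le_of_eq ?_)
    (le_iSup₂ (f := fun f (_ : f ∈ admissible B) => ((f y - f x : ℝ) : EReal)) _
      (hB.neg_mem_admissible hf))
  congr 1
  simp only [Pi.neg_apply]
  ring

lemma coe_toReal_intrinsicDist (x y : E d) :
    (((intrinsicDist B x y).toReal : ℝ) : EReal) = intrinsicDist B x y := by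
  apply EReal.coe_toReal
  · have h := hB.intrinsicDist_le (Bornology.IsBounded.subset
      (isBounded_convexHull.2 (Set.toFinite {x, y}).isBounded)
      (convexHull_pair x y).ge) (x := x) (y := y) subset_rfl
    exact ne_top_of_le_ne_top (EReal.coe_ne_top _) h
  · exact ne_bot_of_le_ne_bot (EReal.coe_ne_bot _) (hB.le_intrinsicDist x y)

lemma le_toReal_intrinsicDist (x y : E d) :
    1 / √(⨆ z, lam₂ z) * ‖x - y‖ ≤ (intrinsicDist B x y).toReal := by
  rw [← EReal.coe_le_coe_iff, hB.coe_toReal_intrinsicDist]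
  exact hB.le_intrinsicDist x y

/-- The intrinsic metric as a metric space structure. -/
noncomputable abbrev intrinsicMetricSpace : MetricSpace (E d) where
  dist x y := (intrinsicDist B x y).toReal
  dist_self x := by
    have h : intrinsicDist B x x ≤ (0 : ℝ) := iSup₂_le fun f _ => by simp
    refine le_antisymm ?_ (le_trans (by positivity) (hB.le_toReal_intrinsicDist x x))
    rwa [← hB.coe_toReal_intrinsicDist, EReal.coe_le_coe_iff] at h
  dist_comm x y := by
    rw [le_antisymm (hB.intrinsicDist_comm_le x y) (hB.intrinsicDist_comm_le y x)]
  dist_triangle x y z := by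
    rw [← EReal.coe_le_coe_iff, EReal.coe_add]
    simp only [hB.coe_toReal_intrinsicDist]
    refine iSup₂_le fun f hf => ?_
    have h : ∀ a b, ((f a - f b : ℝ) : EReal) ≤ intrinsicDist B a b := fun a b =>
      le_iSup₂ (f := fun f (_ : f ∈ admissible B) => ((f a - f b : ℝ) : EReal)) f hf
    rw [← sub_add_sub_cancel (f x) (f y) (f z), EReal.coe_add]
    exact add_le_add (h x y) (h y z)
  eq_of_dist_eq_zero {x y} h := by
    have h1 := hB.le_toReal_intrinsicDist x y
    have hC : 0 < 1 / √(⨆ z, lam₂ z) := one_div_pos.2 (Real.sqrt_pos.2 hB.iSup_upper_pos)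
    have h2 : ‖x - y‖ ≤ 0 := by
      by_contra! hlt
      have := mul_pos hC hlt
      change (intrinsicDist B x y).toReal = 0 at h
      linarith
    exact sub_eq_zero.1 (norm_le_zero_iff.1 h2)

/-- The intrinsic metric is locally comparable with the Euclidean one. -/
lemma intrinsicMetricSpace_topology :
    hB.intrinsicMetricSpace.toPseudoMetricSpace.toUniformSpace.toTopologicalSpace =
      euclideanTopology d := by
  refine TopologicalSpace.ext_nhds fun x => ?_
  have b1 := @Metric.nhds_basis_ball _ hB.intrinsicMetricSpace.toPseudoMetricSpace x
  have b2 := Metric.nhds_basis_ball (x := x)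
  have hC : 0 < 1 / √(⨆ z, lam₂ z) := one_div_pos.2 (Real.sqrt_pos.2 hB.iSup_upper_pos)
  refine b1.ext b2 (fun ε hε => ?_) fun ε hε => ?_
  · have hm := hB.sInf_pos (Metric.isBounded_ball (x := x) (r := 1))
      ⟨x, Metric.mem_ball_self one_pos⟩
    set K := 1 / √(sInf (lam₁ '' Metric.ball x 1)) with hK
    have hK0 : 0 < K := one_div_pos.2 (Real.sqrt_pos.2 hm)
    refine ⟨min 1 (ε / K), by positivity, fun y hy => ?_⟩
    rw [Metric.mem_ball, dist_eq_norm, lt_min_iff] at hy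
    have hseg : segment ℝ y x ⊆ Metric.ball x 1 := (convex_ball x 1).segment_subset
      (by rw [Metric.mem_ball, dist_eq_norm]; exact hy.1) (Metric.mem_ball_self one_pos)
    have h := hB.intrinsicDist_le Metric.isBounded_ball hseg
    rw [← hB.coe_toReal_intrinsicDist, EReal.coe_le_coe_iff] at h
    change (intrinsicDist B y x).toReal < ε
    refine h.trans_lt ?_
    rw [mul_comm, ← hK]
    exact (lt_div_iff₀ hK0).1 hy.2
  · refine ⟨1 / √(⨆ z, lam₂ z) * ε, by positivity, fun y hy => ?_⟩
    have hy' : (intrinsicDist B y x).toReal < 1 / √(⨆ z, lam₂ z) * ε := hy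
    rw [Metric.mem_ball, dist_eq_norm]
    exact lt_of_mul_lt_mul_left ((hB.le_toReal_intrinsicDist y x).trans_lt hy') hC.le

end IsDegenerateElliptic

end DegenerateForm

theorem mainTheorem10 (d : ℕ) (hd : 2 ≤ d)
    (B : EuclideanSpace ℝ (Fin d) → Matrix (Fin d) (Fin d) ℝ)
    (lam₁ lam₂ : BoundedContinuousFunction (EuclideanSpace ℝ (Fin d)) ℝ)
    (hB : DegenerateForm.IsDegenerateElliptic B lam₁ lam₂) :
    (∀ x y : EuclideanSpace ℝ (Fin d),
      ((1 / √(⨆ z, lam₂ z) * ‖x - y‖ : ℝ) : EReal) ≤ DegenerateForm.intrinsicDist B x y) ∧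
    (∀ D : Set (EuclideanSpace ℝ (Fin d)), Bornology.IsBounded D →
      ∀ x ∈ D, ∀ y ∈ D, segment ℝ x y ⊆ D →
        0 < sInf (lam₁ '' D) ∧
        DegenerateForm.intrinsicDist B x y ≤
          ((1 / √(sInf (lam₁ '' D)) * ‖x - y‖ : ℝ) : EReal)) ∧
    (∀ D : Set (EuclideanSpace ℝ (Fin d)), Bornology.IsBounded D → ∀ x ∈ D, ∀ y ∈ D,
        0 < sInf (lam₁ '' (convexHull ℝ D)) ∧
        DegenerateForm.intrinsicDist B x y ≤
          ((1 / √(sInf (lam₁ '' (convexHull ℝ D))) * ‖x - y‖ : ℝ) : EReal)) ∧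
    (∃ m : MetricSpace (EuclideanSpace ℝ (Fin d)),
      (∀ x y, ((m.dist x y : ℝ) : EReal) = DegenerateForm.intrinsicDist B x y) ∧
      m.toPseudoMetricSpace.toUniformSpace.toTopologicalSpace =
        DegenerateForm.euclideanTopology d) := by
  refine ⟨hB.le_intrinsicDist, fun D hD x hx y _ hxy => ?_, fun D hD x hx y hy => ?_,
    hB.intrinsicMetricSpace, hB.coe_toReal_intrinsicDist, hB.intrinsicMetricSpace_topology⟩
  · exact ⟨hB.sInf_pos hD ⟨x, hx⟩, hB.intrinsicDist_le hD hxy⟩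
  · have hD' : Bornology.IsBounded (convexHull ℝ D) := isBounded_convexHull.2 hD
    have hx' := subset_convexHull ℝ D hx
    exact ⟨hB.sInf_pos hD' ⟨x, hx'⟩, hB.intrinsicDist_le hD'
      ((convex_convexHull ℝ D).segment_subset hx' (subset_convexHull ℝ D hy))⟩
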